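/- **Setting.** Let $A\in\mathbb R^{n\times d}$ have singular values $\sigma_1(A)\ge\sigma_2(A)\ge\dots$ (with $\sigma_i(A)=0$ beyond the rank), let $y\in\mathbb R^d$, $\lambda>0$, $H=A^\top A+\lambda I$, $\kappa_\lambda=\sigma_1(A)^2/\lambda$, let $\mathrm{nnz}(A)$ be the number of nonzero entries and $\mathrm{sr}(A)=\|A\|_F^2/\sigma_1(A)^2$ the stable rank. Let $P_{A_\lambda}=f(A^\top A)$, where $f(x)=1$ for $x\ge\lambda$ and $f(x)=0$ for $x<\lambda$, be the projection onto the principal components with squared singular value at least $\lambda$. Write $\|x\|_M=\sqrt{x^\top Mx}$. A *ridge solver* for $(A,\lambda)$ is a (possibly randomized) procedure $\mathrm{ridge}(A,\lambda,z,\epsilon,\delta)$ that, for all $z\in\mathbb R^d$ and $\epsilon,\delta>0$, returns with probability at least $1-\delta$ a vector $\tilde x$ with $\|\tilde x-H^{-1}z\|_{H}\le\epsilon\|z\|_{H^{-1}}$. Different calls use independent randomness. **Algorithm pc-proj** (constants $c_1,c_2$; input $A,y$, error $\epsilon$, failure rate $\delta$, threshold $\lambda$, gap $\gamma$). Put $q=\lceil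 c_1\gamma^{-2}\log(1/\epsilon)\rceil$, $\epsilon'=c_2^{-1}\epsilon^2\gamma^2/\sqrt{\kappa_\lambda}$, $\delta'=\delta/(2q+1)$ and write $\mathcal A(x)=\mathrm{ridge}(A,\lambda,A^\top Ax,\epsilon',\delta')$. Set $s:=\mathcal A(y)$, $w:=s-\tfrac12y$; for $k=0,\dots,q-1$ set $t:=w-\mathcal A(w)$, $w:=4\,\tfrac{2k+1}{2k+2}\,\mathcal A(t)$, $s:=s+w$. Return $s$. The running time counts operations on real numbers (in exact arithmetic) and random draws; a product of $A$ or $A^\top$ with a vector costs $2\,\mathrm{nnz}(A)$, and $\sigma_1(A)$ is treated as known. **Theorem.** There is an absolute constant $C$ such that for all $c_1,c_2\ge C$ there is a constant $K$, depending only on $c_1,c_2$, such that the following holds for all $n,d,A,y$, all $\epsilon,\delta\in(0,1)$, $\lambda>0$, $\gamma\in(0,1/4)$ and all $k\ge1$ with $$\frac{1}{1-4\gamma}\,\sigma_{k+1}(A)^2\le\lambda\le(1-4\gamma)\,\sigma_k(A)^2 .$$ 1. *Accuracy.* With any ridge solver for $(A,\lambda)$ as subroutine, pc-proj returns $s$ with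 $\|s-P_{A_\lambda}y\|_2\le\epsilon\|y\|_2$ with probability at least $1-\delta$; if the solver never fails, then pc-proj never fails. 2. *Number of calls.* pc-proj makes exactly $2q+1$ ridge calls, and $2q+1\le K\gamma^{-2}\log(1/\epsilon)$ if $\epsilon\le1/2$. 3. *Running time.* Suppose $d\le\mathrm{nnz}(A)$. If every call $\mathrm{ridge}(A,\lambda,\cdot,\epsilon',\delta')$ takes time at most $T\ge 0$, then pc-proj takes time at most $(2q+1)(T+K\,\mathrm{nnz}(A))$. If moreover $\epsilon\le1/2$, then: * if the calls take time at most $W\log(1/\epsilon')$ with $W\ge0$, then pc-proj takes time at most $K(\mathrm{nnz}(A)+W)\gamma^{-2}\log(1/\epsilon)\log(\kappa_\lambda/(\epsilon\gamma))$; if they take time at most $W\log(1/(\delta'\epsilon'))$, then it takes time at most $K(\mathrm{nnz}(A)+W)\gamma^{-2}\log(1/\epsilon)\log(\kappa_\lambda/(\epsilon\gamma\delta))$; * with Nesterov's accelerated gradient descent (step size $1/L$, $L=\sigma_1(A)^2+\lambda$, momentum $\frac{\sqrt L-\sqrt\lambda}{\sqrt L+\sqrt\lambda}$, $\lceil2\sqrt{L/\lambda}\log(2/\epsilon)\rceil$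 steps from $0$ on an instance with accuracy $\epsilon$) as the subroutine ridge, pc-proj is deterministic, returns $s$ with $\|s-P_{A_\lambda}y\|_2\le\epsilon\|y\|_2$, and takes time at most $$K\,\mathrm{nnz}(A)\sqrt{\kappa_\lambda}\,\gamma^{-2}\log(1/\epsilon)\log\!\big(\kappa_\lambda/(\epsilon\gamma)\big);$$ * with variance-reduced stochastic gradient descent as the subroutine ridge (from a reference point $c$ with $G=Hc-z$, each step draws a row $a_i$ with probability $\|a_i\|_2^2/\|A\|_F^2$ and sets $x:=x-\eta\big(\tfrac{\|A\|_F^2}{\|a_i\|_2^2}a_ia_i^\top(x-c)+\lambda(x-c)+G\big)$, $\eta=\frac1{8(\|A\|_F^2+\lambda)}$; $\lceil16(\|A\|_F^2+\lambda)/\lambda\rceil$ steps per epoch, each epoch starting at its reference point and returning the average of its points (the last one excluded) as the next reference point, $\lceil\log_2(1/(\epsilon^2\delta))\rceil$ epochs from $0$ on an instance with accuracy $\epsilon$ and failure rate $\delta$), pc-proj returns $s$ with $\|s-P_{A_\lambda}y\|_2\le\epsilon\|y\|_2$ with probability at least $1-\delta$ and always takes time at most $$K\big(\mathrm{nnz}(A)+d\,\mathrm{sr}(A)\kappa_\lambda\big)\gamma^{-2}\log(1/\epsilon)\log\!\big(\kappa_\lambda/(\epsilon\gamma\delta)\big).$$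 -/

import Mathlib

open scoped ENNReal Matrix

noncomputable section

namespace PCP

/-! ### Matrices and vectors -/

/-- `ℝ^d` with the Euclidean norm. -/
abbrev Vec (d : ℕ) : Type := EuclideanSpace ℝ (Fin d)

/-- Matrix-vector product `A x`, as a Euclidean vector. -/
def mulE {n d : ℕ} (A : Matrix (Fin n) (Fin d) ℝ) (x : Vec d) : Vec n :=
  WithLp.toLp 2 (A *ᵥ x.ofLp)

/-- `i`-th row of `A`, as a Euclidean vector. -/
def row {n d : ℕ} (A : Matrix (Fin n) (Fin d) ℝ) (i : Fin n) : Vec d :=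
  WithLp.toLp 2 (A i)

/-- `‖x‖_M = √(xᵀ M x)`. -/
def matNorm {d : ℕ} (M : Matrix (Fin d) (Fin d) ℝ) (x : Vec d) : ℝ :=
  √(x.ofLp ⬝ᵥ (M *ᵥ x.ofLp))

/-- The singular values `σ_1(A) ≥ σ_2(A) ≥ …`, indexed from `1` as usual, and equal to `0` beyond
the rank of `A`. (Mathlib's sequence is indexed from `0`.) -/
def sigma {n d : ℕ} (A : Matrix (Fin n) (Fin d) ℝ) (i : ℕ) : ℝ :=
  (Matrix.toEuclideanLin A).singularValues (i - 1)

/-- Number of nonzero entries. -/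
def nnz {n d : ℕ} (A : Matrix (Fin n) (Fin d) ℝ) : ℕ :=
  Set.ncard {p : Fin n × Fin d | A p.1 p.2 ≠ 0}

/-- Squared Frobenius norm `‖A‖_F²`. -/
def frobSq {n d : ℕ} (A : Matrix (Fin n) (Fin d) ℝ) : ℝ := ∑ i, ∑ j, A i j ^ 2

/-- Stable rank `‖A‖_F² / ‖A‖_2²`, where `‖A‖_2 = σ_1(A)`. -/
def stableRank {n d : ℕ} (A : Matrix (Fin n) (Fin d) ℝ) : ℝ := frobSq A / sigma A 1 ^ 2

/-- `κ_λ = σ_1(A)² / λ`. -/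
def kappa {n d : ℕ} (A : Matrix (Fin n) (Fin d) ℝ) (lam : ℝ) : ℝ := sigma A 1 ^ 2 / lam

/-- The regularized Gram matrix `Aᵀ A + λ I`. -/
def gram {n d : ℕ} (A : Matrix (Fin n) (Fin d) ℝ) (lam : ℝ) : Matrix (Fin d) (Fin d) ℝ :=
  Aᵀ * A + lam • (1 : Matrix (Fin d) (Fin d) ℝ)

/-- The projection `P_{A_λ} = f(Aᵀ A)` onto the principal components of `A` with squared singular
value at least `λ`, where `f` is the step function at `λ`. -/
def topProj {n d : ℕ} (A : Matrix (Fin n) (Fin d) ℝ) (lam : ℝ) : Matrix (Fin d) (Fin d) ℝ :=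
  cfc (fun x : ℝ => if lam ≤ x then (1 : ℝ) else 0) (Aᵀ * A)

/-! ### Randomized computations with a running time

The running time counts arithmetic operations on real numbers (additions, multiplications,
divisions, roots, logarithms, roundings) and random draws. -/

/-- Outcome of one run: the value returned, the number of elementary operations spent, and the
number of calls to the ridge regression subroutine. -/
structure Outcome (α : Type) where
  value : α
  time : ℕ
  calls : ℕ

/-- A randomized computation: the distribution of its outcome. -/
def Comp (α : Type) : Type := PMF (Outcome α)

namespace Comp

/-- Sequential composition uses fresh randomness for the second computation, and adds up
running times and call counts. -/
instance : Monad Comp where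
  pure a := PMF.pure ⟨a, 0, 0⟩
  bind p f := PMF.bind p fun o =>
    PMF.map (fun o' => ⟨o'.value, o.time + o'.time, o.calls + o'.calls⟩) (f o.value)

/-- Compute the value `v` with `t` elementary operations. -/
def exec {α : Type} (t : ℕ) (v : α) : Comp α := PMF.pure ⟨v, t, 0⟩

/-- Draw from `p`; one unit of time. -/
def draw {α : Type} (p : PMF α) : Comp α := PMF.map (fun a => ⟨a, 1, 0⟩) p

/-- Run `p` as one call to the ridge regression subroutine. -/
def call {α : Type} (p : Comp α) : Comp α := PMF.map (fun o => ⟨o.value, o.time, 1⟩) p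

/-- The property `Q` holds for every possible outcome. -/
def Surely {α : Type} (p : Comp α) (Q : Outcome α → Prop) : Prop := ∀ o ∈ PMF.support p, Q o

/-- The running time never exceeds `T`. -/
def TimeLE {α : Type} (p : Comp α) (T : ℝ) : Prop := p.Surely fun o => (o.time : ℝ) ≤ T

/-- The probability that the returned value satisfies `Q`. -/
def prob {α : Type} (p : Comp α) (Q : α → Prop) : ℝ≥0∞ :=
  PMF.toOuterMeasure p {o | Q o.value}

end Comp

/-! ### Elementary vector operations with their costs -/

def vadd {d : ℕ} (x y : Vec d) : Comp (Vec d) := Comp.exec d (x + y)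

def vsub {d : ℕ} (x y : Vec d) : Comp (Vec d) := Comp.exec d (x - y)

def vscale {d : ℕ} (a : ℝ) (x : Vec d) : Comp (Vec d) := Comp.exec d (a • x)

/-- One multiplication and one addition for every nonzero entry. -/
def matVec {n d : ℕ} (A : Matrix (Fin n) (Fin d) ℝ) (x : Vec d) : Comp (Vec n) :=
  Comp.exec (2 * nnz A) (mulE A x)

def dot {d : ℕ} (x y : Vec d) : Comp ℝ := Comp.exec (2 * d) (inner ℝ x y)

/-- `Aᵀ A x`, by two matrix-vector products. -/
def gramVec {n d : ℕ} (A : Matrix (Fin n) (Fin d) ℝ) (x : Vec d) : Comp (Vec d) := do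
  let u ← matVec A x
  matVec Aᵀ u

/-! ### Ridge regression solvers -/

/-- A (possibly randomized) procedure `ridge(A, λ, y, ε, δ)`. -/
abbrev RidgeProc (n d : ℕ) : Type :=
  Matrix (Fin n) (Fin d) ℝ → ℝ → Vec d → ℝ → ℝ → Comp (Vec d)

/-- `z` is an `ε`-approximation of `x* = (Aᵀ A + λ I)⁻¹ y`:
`‖z - x*‖_{Aᵀ A + λ I} ≤ ε ‖y‖_{(Aᵀ A + λ I)⁻¹}`. -/
def RidgeApprox {n d : ℕ} (A : Matrix (Fin n) (Fin d) ℝ) (lam : ℝ) (y : Vec d) (ε : ℝ)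
    (z : Vec d) : Prop :=
  matNorm (gram A lam) (z - mulE (gram A lam)⁻¹ y) ≤ ε * matNorm (gram A lam)⁻¹ y

/-- `ridge` solves every ridge regression problem on `A`, `λ`, with failure probability at
most `δ`. -/
def IsRidgeSolver {n d : ℕ} (ridge : RidgeProc n d) (A : Matrix (Fin n) (Fin d) ℝ)
    (lam : ℝ) : Prop :=
  ∀ (y : Vec d) (ε δ : ℝ), 0 < ε → 0 < δ →
    1 - ENNReal.ofReal δ ≤ (ridge A lam y ε δ).prob (RidgeApprox A lam y ε)

/-- `ridge` solves every ridge regression problem on `A`, `λ`, and never fails. -/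
def IsSureRidgeSolver {n d : ℕ} (ridge : RidgeProc n d) (A : Matrix (Fin n) (Fin d) ℝ)
    (lam : ℝ) : Prop :=
  ∀ (y : Vec d) (ε δ : ℝ), 0 < ε → 0 < δ →
    (ridge A lam y ε δ).Surely fun o => RidgeApprox A lam y ε o.value

/-! ### Principal component projection -/

/-- Number of iterations `q = ⌈c₁ γ⁻² log(1/ε)⌉`. -/
def iters (c₁ ε γ : ℝ) : ℕ := ⌈c₁ * γ⁻¹ ^ 2 * Real.log (1 / ε)⌉₊

/-- Accuracy `ε' = c₂⁻¹ ε² γ² / √κ_λ` of the ridge regression calls. -/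
def innerEps {n d : ℕ} (c₂ : ℝ) (A : Matrix (Fin n) (Fin d) ℝ) (lam ε γ : ℝ) : ℝ :=
  c₂⁻¹ * ε ^ 2 * γ ^ 2 / √(kappa A lam)

/-- Failure rate `δ' = δ / (2q+1)` of each of the `2q+1` ridge regression calls. -/
def innerDelta (c₁ ε δ γ : ℝ) : ℝ := δ / (2 * (iters c₁ ε γ : ℝ) + 1)

/-- Approximate application of `(Aᵀ A + λ I)⁻¹ Aᵀ A` to `x` by one ridge regression call. -/
def softProj {n d : ℕ} (ridge : RidgeProc n d) (A : Matrix (Fin n) (Fin d) ℝ) (lam ε' δ' : ℝ)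
    (x : Vec d) : Comp (Vec d) := do
  let v ← gramVec A x
  Comp.call (ridge A lam v ε' δ')

/-- The first `k` passes of the main loop, started from `(s, w)`. -/
def pcLoop {d : ℕ} (R : Vec d → Comp (Vec d)) (s w : Vec d) : ℕ → Comp (Vec d × Vec d)
  | 0 => pure (s, w)
  | k + 1 => do
    let st ← pcLoop R s w k
    let r ← R st.2
    let t ← vsub st.2 r
    let u ← R t
    let a ← Comp.exec 6 (4 * ((2 * (k : ℝ) + 1) / (2 * (k : ℝ) + 2)))
    let w' ← vscale a u
    let s' ← vadd st.1 w'
    pure (s', w')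

/-- Algorithm `pc-proj` with constants `c₁`, `c₂` and subroutine `ridge`, on the input
`A`, `y`, error `ε`, failure rate `δ`, threshold `λ`, gap `γ`. -/
def pcProj {n d : ℕ} (ridge : RidgeProc n d) (c₁ c₂ : ℝ) (A : Matrix (Fin n) (Fin d) ℝ)
    (y : Vec d) (ε δ lam γ : ℝ) : Comp (Vec d) := do
  let q ← Comp.exec 6 (iters c₁ ε γ)
  let ε' ← Comp.exec 8 (innerEps c₂ A lam ε γ)
  let δ' ← Comp.exec 3 (innerDelta c₁ ε δ γ)
  let s ← softProj ridge A lam ε' δ' y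
  let h ← vscale (1 / 2) y
  let w ← vsub s h
  let st ← pcLoop (softProj ridge A lam ε' δ') s w q
  pure st.1

/-! ### A deterministic ridge regression solver: accelerated gradient descent -/

/-- The gradient `Aᵀ A x + λ x - y` of the ridge regression objective. -/
def ridgeGrad {n d : ℕ} (A : Matrix (Fin n) (Fin d) ℝ) (lam : ℝ) (y x : Vec d) :
    Comp (Vec d) := do
  let v ← gramVec A x
  let p ← vscale lam x
  let s ← vadd v p
  vsub s y

/-- `N` steps of Nesterov's method from the origin, with step size `1/L` and momentum `β`.
The state is the current point and the extrapolated point. -/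
def agdLoop {n d : ℕ} (A : Matrix (Fin n) (Fin d) ℝ) (lam L β : ℝ) (y : Vec d) :
    ℕ → Comp (Vec d × Vec d)
  | 0 => Comp.exec d (0, 0)
  | t + 1 => do
    let st ← agdLoop A lam L β y t
    let g ← ridgeGrad A lam y st.2
    let h ← vscale (1 / L) g
    let x ← vsub st.2 h
    let m ← vsub x st.1
    let b ← vscale β m
    let z ← vadd x b
    pure (x, z)

/-- Accelerated gradient descent for ridge regression, with `L = σ_1(A)² + λ` and
`⌈2 √(L/λ) log(2/ε)⌉` steps. It uses no randomness and ignores `δ`. -/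
def agdRidge (n d : ℕ) : RidgeProc n d := fun A lam y ε _ => do
  let L ← Comp.exec 2 (sigma A 1 ^ 2 + lam)
  let β ← Comp.exec 5 ((√L - √lam) / (√L + √lam))
  let N ← Comp.exec 7 ⌈2 * √(L / lam) * Real.log (2 / ε)⌉₊
  let st ← agdLoop A lam L β y N
  pure st.1

/-! ### A stochastic ridge regression solver: variance-reduced stochastic gradient descent -/

/-- Squared Euclidean norm of the `i`-th row. -/
def rowSq {n d : ℕ} (A : Matrix (Fin n) (Fin d) ℝ) (i : Fin n) : ℝ := ∑ j, A i j ^ 2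

theorem tsum_rowSq_ne_zero {n d : ℕ} {A : Matrix (Fin n) (Fin d) ℝ} (hA : A ≠ 0) :
    ∑' i, ENNReal.ofReal (rowSq A i) ≠ 0 := by
  intro h
  apply hA
  ext i j
  have hi : ENNReal.ofReal (rowSq A i) = 0 := (ENNReal.tsum_eq_zero.1 h) i
  have h0 : rowSq A i ≤ 0 := ENNReal.ofReal_eq_zero.1 hi
  have h1 : A i j ^ 2 ≤ rowSq A i :=
    Finset.single_le_sum (f := fun j => A i j ^ 2) (fun _ _ => sq_nonneg _) (Finset.mem_univ j)
  have h2 : A i j ^ 2 = 0 := le_antisymm (h1.trans h0) (sq_nonneg _)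
  simpa using h2

theorem tsum_rowSq_ne_top {n d : ℕ} (A : Matrix (Fin n) (Fin d) ℝ) :
    ∑' i, ENNReal.ofReal (rowSq A i) ≠ ⊤ := by
  rw [tsum_fintype]
  exact ENNReal.sum_ne_top.2 fun i _ => ENNReal.ofReal_ne_top

/-- The random row index that equals `i` with probability `‖a_i‖² / ‖A‖_F²`. -/
def rowDist {n d : ℕ} (A : Matrix (Fin n) (Fin d) ℝ) (hA : A ≠ 0) : PMF (Fin n) :=
  PMF.normalize (fun i => ENNReal.ofReal (rowSq A i)) (tsum_rowSq_ne_zero hA)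
    (tsum_rowSq_ne_top A)

/-- `t` stochastic steps from the reference point `c` whose gradient is `G`. The state is the
current point and the sum of the points visited before it. -/
def svrgInner {n d : ℕ} (A : Matrix (Fin n) (Fin d) ℝ) (hA : A ≠ 0) (lam F η : ℝ)
    (c G : Vec d) : ℕ → Comp (Vec d × Vec d)
  | 0 => Comp.exec d (c, 0)
  | t + 1 => do
    let st ← svrgInner A hA lam F η c G t
    let sum ← vadd st.2 st.1
    let i ← Comp.draw (rowDist A hA)
    let u ← vsub st.1 c
    let r ← dot (row A i) u
    let a ← Comp.exec 2 (F / rowSq A i * r)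
    let v ← vscale a (row A i)
    let p ← vscale lam u
    let g₁ ← vadd v p
    let g₂ ← vadd g₁ G
    let g₃ ← vscale η g₂
    let x ← vsub st.1 g₃
    pure (x, sum)

/-- `k` epochs of `m` stochastic steps; each epoch returns the average of its points, which is
the reference point of the next one. -/
def svrgEpochs {n d : ℕ} (A : Matrix (Fin n) (Fin d) ℝ) (hA : A ≠ 0) (lam F η : ℝ) (m : ℕ)
    (y : Vec d) : ℕ → Comp (Vec d)
  | 0 => Comp.exec d 0
  | k + 1 => do
    let c ← svrgEpochs A hA lam F η m y k
    let G ← ridgeGrad A lam y c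
    let st ← svrgInner A hA lam F η c G m
    vscale (1 / (m : ℝ)) st.2

open Classical in
/-- Variance-reduced stochastic gradient descent for ridge regression. The first line accounts for
computing all row norms, `F = ‖A‖_F²`, and the table from which rows are then drawn. -/
def svrgRidge (n d : ℕ) : RidgeProc n d := fun A lam y ε δ =>
  if hA : A = 0 then vscale (1 / lam) y
  else do
    let F ← Comp.exec (10 * nnz A) (frobSq A)
    let η ← Comp.exec 3 (1 / (8 * (F + lam)))
    let m ← Comp.exec 4 ⌈16 * (F + lam) / lam⌉₊
    let K ← Comp.exec 6 ⌈Real.logb 2 (1 / (ε ^ 2 * δ))⌉₊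
    svrgEpochs A hA lam F η m y K

end PCP

end

/-! In an eigenbasis of `Aᵀ A` an exact ridge call acts on the eigenvalue `m` as multiplication by
`r = m/(m+λ)`, a soft step that crosses `1/2` at `m = λ`. Put `β = 2r - 1`. The gap hypothesis gives
`2γ ≤ |β| ≤ 1`, and the projection multiplies by `(1 + sgn β)/2`. Now `sgn β = β (1 - (1 -
β²))^(-1/2) = β ∑ cb k (1 - β²)^k`, and `1 - β² = 4r(1 - r)`, so one pass of the loop, with two
calls, passes from one term of this series to the next. The coefficients decrease, hence truncation
costs a geometric factor (`abs_one_sub_mul_sum_cb_le`), and `γ⁻² log(1/ε)` passes suffice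
(`exp_iters_le`).

The delicate point is stability with inexact calls. A call with accuracy `ε'` has Euclidean relative
error `e = ε' √κ` (`norm_sub_le_of_ridgeApprox`). If each pass merely added `e` times the current
term, the error of the `k`-th term would be about `k e ρ^k`. But the exact `k`-th term is of order
`ρ^k/(k+1)` (`cb_mul_pow_le`), and the series coefficient shrinks by `1 - 1/(2(k+1))` per pass; the
two effects balance, so the error stays of order `e ρ^k` (`error_step`, `loop_step`). Its sum over
`k` is of order `e/γ²`, which explains the choice of `ε'`. A union bound over the `2q+1` calls
handles failures (`fail_pcProj_le`).

Accelerated gradient descent is analysed with a potential that contracts by `1 - √(λ/L)` per step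
(`agd_potential`). For the stochastic solver a one-step variance bound (`svrg_step_le`) gives
halving of the expected squared error per epoch (`ex_epoch_le`), and Markov's inequality finishes
(`isRidgeSolver_svrgRidge`). The running times come from adding costs and absorbing constants into
logarithms that are at least `1`. -/

noncomputable section

namespace PCP

/-! ### Expectations, failure probabilities, running times and call counts of randomized
computations. -/

namespace Comp

variable {α β : Type}

/-- The distribution of the outcome. -/
def law (p : Comp α) : PMF (Outcome α) := p

/-- Expectation of `g` of the returned value. -/
def ex (p : Comp α) (g : α → ℝ≥0∞) : ℝ≥0∞ := ∑' o, p.law o * g o.value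

theorem tsum_pmf_bind {α β : Type} (p : PMF α) (f : α → PMF β) (g : β → ℝ≥0∞) :
    ∑' b, (p.bind f) b * g b = ∑' a, p a * ∑' b, f a b * g b := by
  simp_rw [PMF.bind_apply, ← ENNReal.tsum_mul_right, ← ENNReal.tsum_mul_left]
  rw [ENNReal.tsum_comm]
  simp_rw [mul_assoc]

theorem tsum_pmf_pure {α : Type} (a : α) (g : α → ℝ≥0∞) :
    ∑' b, (PMF.pure a) b * g b = g a := by
  rw [tsum_eq_single a]
  · simp
  · intro b hb
    simp [PMF.pure_apply, hb]

theorem tsum_pmf_map {α β : Type} (p : PMF α) (f : α → β) (g : β → ℝ≥0∞) :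
    ∑' b, (p.map f) b * g b = ∑' a, p a * g (f a) := by
  rw [PMF.map, tsum_pmf_bind]
  simp

@[simp] theorem ex_bind (p : Comp α) (f : α → Comp β) (g : β → ℝ≥0∞) :
    ex (p >>= f) g = ex p fun v => ex (f v) g := by
  refine (tsum_pmf_bind p.law _ _).trans (tsum_congr fun o => ?_)
  exact congrArg (p.law o * ·) (tsum_pmf_map (f o.value).law _ _)

@[simp] theorem ex_pure (a : α) (g : α → ℝ≥0∞) : ex (pure a) g = g a :=
  tsum_pmf_pure (⟨a, 0, 0⟩ : Outcome α) fun o => g o.value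

@[simp] theorem ex_exec (t : ℕ) (a : α) (g : α → ℝ≥0∞) : ex (exec t a) g = g a :=
  tsum_pmf_pure (⟨a, t, 0⟩ : Outcome α) fun o => g o.value

@[simp] theorem ex_call (p : Comp α) (g : α → ℝ≥0∞) : ex (call p) g = ex p g :=
  tsum_pmf_map _ _ _

@[simp] theorem ex_draw (p : PMF α) (g : α → ℝ≥0∞) : ex (draw p) g = ∑' a, p a * g a :=
  tsum_pmf_map _ _ _

theorem ex_mono (p : Comp α) {g h : α → ℝ≥0∞} (H : ∀ v, g v ≤ h v) : ex p g ≤ ex p h :=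
  ENNReal.tsum_le_tsum fun _ => mul_le_mul_right (H _) _

theorem ex_const (p : Comp α) (c : ℝ≥0∞) : ex p (fun _ => c) = c := by
  rw [ex, ENNReal.tsum_mul_right, PMF.tsum_coe, one_mul]

theorem ex_add (p : Comp α) (g h : α → ℝ≥0∞) :
    ex p (fun v => g v + h v) = ex p g + ex p h := by
  simp_rw [ex, mul_add, ENNReal.tsum_add]

theorem ex_const_mul (p : Comp α) (c : ℝ≥0∞) (g : α → ℝ≥0∞) :
    ex p (fun v => c * g v) = c * ex p g := by
  simp_rw [ex, mul_left_comm _ c, ENNReal.tsum_mul_left]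

open Classical in
/-- The probability that the returned value violates `Q`. -/
def fail (p : Comp α) (Q : α → Prop) : ℝ≥0∞ := ex p fun v => if Q v then 0 else 1

/-- Union bound for two stages: the second one only has to behave well after a good outcome of the
first. -/
theorem fail_bind_le {p : Comp α} {f : α → Comp β} {P : α → Prop} {Q : β → Prop} {a b : ℝ≥0∞}
    (hp : fail p P ≤ a) (hf : ∀ v, P v → fail (f v) Q ≤ b) : fail (p >>= f) Q ≤ a + b := by
  classical
  have h : fail (p >>= f) Q ≤ ex p (fun v => (if P v then 0 else 1) + b) := by
    rw [fail, ex_bind]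
    refine ex_mono p fun v => ?_
    by_cases hv : P v
    · rw [if_pos hv, zero_add]
      exact hf v hv
    · rw [if_neg hv]
      refine le_trans ?_ le_self_add
      refine (ex_mono (h := fun _ => 1) _ fun w => ?_).trans (ex_const _ _).le
      split_ifs <;> simp
  refine h.trans ?_
  rw [ex_add, ex_const]
  exact add_le_add hp le_rfl

theorem fail_bind_eq (p : Comp α) (f : α → Comp β) (Q : β → Prop) :
    fail (p >>= f) Q = ex p fun v => fail (f v) Q := ex_bind _ _ _

@[simp] theorem fail_exec_bind (t : ℕ) (a : α) (f : α → Comp β) (Q : β → Prop) :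
    fail (exec t a >>= f) Q = fail (f a) Q := by
  rw [fail_bind_eq, ex_exec]

theorem fail_pure {a : α} {Q : α → Prop} (h : Q a) : fail (pure a) Q = 0 := by
  simp [fail, h]

theorem fail_exec {t : ℕ} {a : α} {Q : α → Prop} (h : Q a) : fail (exec t a) Q = 0 := by
  simp [fail, h]

theorem fail_mono (p : Comp α) {P Q : α → Prop} (h : ∀ v, P v → Q v) : fail p Q ≤ fail p P := by
  refine ex_mono p fun v => ?_
  by_cases hv : P v
  · simp [hv, h v hv]
  · simp only [hv, if_false]
    split_ifs <;> simp

theorem prob_add_fail (p : Comp α) (Q : α → Prop) : p.prob Q + fail p Q = 1 := by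
  classical
  have h : p.prob Q = ∑' o, {o : Outcome α | Q o.value}.indicator p.law o :=
    PMF.toOuterMeasure_apply p.law _
  rw [h, fail, ex, ← ENNReal.tsum_add, ← PMF.tsum_coe p.law]
  refine tsum_congr fun o => ?_
  by_cases h : Q o.value <;> simp [Set.indicator, h]

theorem le_prob_iff (p : Comp α) (Q : α → Prop) (δ : ℝ≥0∞) : 1 - δ ≤ p.prob Q ↔ fail p Q ≤ δ := by
  have h := prob_add_fail p Q
  have hf : p.fail Q ≠ ⊤ := by
    intro hf
    simp [hf] at h
  rw [tsub_le_iff_right, ← h]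
  have hp : p.prob Q ≠ ⊤ := by
    intro hf
    simp [hf] at h
  exact ENNReal.add_le_add_iff_left hp

theorem surely_iff_fail (p : Comp α) (Q : α → Prop) :
    p.Surely (fun o => Q o.value) ↔ fail p Q = 0 := by
  classical
  simp only [fail, ex, ENNReal.tsum_eq_zero, mul_eq_zero]
  refine forall_congr' fun o => ?_
  change o ∈ p.law.support → _ ↔ _
  rw [PMF.mem_support_iff]
  by_cases h : Q o.value <;> simp [h]

/-- Markov's inequality. -/
theorem mul_fail_le_ex (p : Comp α) (g : α → ℝ≥0∞) (t : ℝ≥0∞) :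
    t * fail p (fun v => g v ≤ t) ≤ ex p g := by
  rw [fail, ← ex_const_mul]
  refine ex_mono p fun v => ?_
  split_ifs with h
  · simp
  · simpa using (not_le.1 h).le

theorem Surely.bind {p : Comp α} {f : α → Comp β} {P : Outcome α → Prop}
    {R : Outcome β → Prop} {Q : Outcome β → Prop}
    (hp : p.Surely P) (hf : ∀ v, (f v).Surely R)
    (h : ∀ o o', P o → R o' → Q ⟨o'.value, o.time + o'.time, o.calls + o'.calls⟩) :
    (p >>= f).Surely Q := by
  intro o ho
  obtain ⟨a, ha, ho⟩ := (PMF.mem_support_bind_iff _ _ _).1 ho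
  obtain ⟨b, hb, rfl⟩ := (PMF.mem_support_map_iff _ _ _).1 ho
  exact h a b (hp a ha) (hf _ b hb)

theorem timeLE_bind {p : Comp α} {f : α → Comp β} {a b : ℝ} (hp : p.TimeLE a)
    (hf : ∀ v, (f v).TimeLE b) : (p >>= f).TimeLE (a + b) :=
  Surely.bind hp hf fun o o' h h' => by push_cast; exact add_le_add h h'

theorem TimeLE.mono {p : Comp α} {a b : ℝ} (hp : p.TimeLE a) (h : a ≤ b) : p.TimeLE b :=
  fun o ho => (hp o ho).trans h

theorem timeLE_pure (a : α) : (pure a : Comp α).TimeLE 0 := by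
  intro o ho
  obtain rfl := (PMF.mem_support_pure_iff _ _).1 ho
  simp

theorem timeLE_exec (t : ℕ) (a : α) : (exec t a).TimeLE t := by
  intro o ho
  obtain rfl := (PMF.mem_support_pure_iff _ _).1 ho
  simp

theorem timeLE_draw (p : PMF α) : (draw p).TimeLE 1 := by
  intro o ho
  obtain ⟨b, -, rfl⟩ := (PMF.mem_support_map_iff _ _ _).1 ho
  simp

theorem timeLE_call {p : Comp α} {a : ℝ} (h : p.TimeLE a) : (call p).TimeLE a := by
  intro o ho
  obtain ⟨b, hb, rfl⟩ := (PMF.mem_support_map_iff _ _ _).1 ho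
  exact h b hb

/-- Every run makes exactly `c` calls. -/
def CallsEq (p : Comp α) (c : ℕ) : Prop := p.Surely fun o => o.calls = c

theorem callsEq_bind {p : Comp α} {f : α → Comp β} {a b : ℕ} (hp : p.CallsEq a)
    (hf : ∀ v, (f v).CallsEq b) : (p >>= f).CallsEq (a + b) :=
  Surely.bind hp hf fun o o' h h' => by
    change o.calls + o'.calls = a + b
    rw [h, h']

theorem callsEq_pure (a : α) : (pure a : Comp α).CallsEq 0 := by
  intro o ho
  obtain rfl := (PMF.mem_support_pure_iff _ _).1 ho
  rfl

theorem callsEq_exec (t : ℕ) (a : α) : (exec t a).CallsEq 0 := by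
  intro o ho
  obtain rfl := (PMF.mem_support_pure_iff _ _).1 ho
  rfl

theorem callsEq_call (p : Comp α) : (call p).CallsEq 1 := by
  intro o ho
  obtain ⟨b, hb, rfl⟩ := (PMF.mem_support_map_iff _ _ _).1 ho
  rfl

/-- Unlike in `timeLE_bind`, the continuation is bounded only at the value `a` actually computed.
This is needed when `a` is an iteration count that enters the time bound. -/
theorem timeLE_exec_bind {t : ℕ} {T : ℝ} {a : α} {f : α → Comp β}
    (h : (f a).TimeLE T) : (exec t a >>= f).TimeLE (t + T) := by
  intro o ho
  obtain ⟨a, ha, ho⟩ := (PMF.mem_support_bind_iff _ _ _).1 ho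
  obtain rfl := (PMF.mem_support_pure_iff _ _).1 ha
  obtain ⟨b, hb, rfl⟩ := (PMF.mem_support_map_iff _ _ _).1 ho
  push_cast
  exact add_le_add le_rfl (h b hb)

theorem callsEq_exec_bind {t c : ℕ} {a : α} {f : α → Comp β} (h : (f a).CallsEq c) :
    (exec t a >>= f).CallsEq c := by
  intro o ho
  obtain ⟨a, ha, ho⟩ := (PMF.mem_support_bind_iff _ _ _).1 ho
  obtain rfl := (PMF.mem_support_pure_iff _ _).1 ha
  obtain ⟨b, hb, rfl⟩ := (PMF.mem_support_map_iff _ _ _).1 ho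
  exact (Nat.zero_add _).trans (h b hb)

end Comp

open PCP.Comp

/-! ### The power series of `(1 - u)^(-1/2)` -/

/-- The coefficient `4⁻ᵏ (2k choose k)` of `uᵏ` in the power series of `(1 - u)^(-1/2)`. -/
def cb (k : ℕ) : ℝ := (k.centralBinom : ℝ) / 4 ^ k

theorem cb_zero : cb 0 = 1 := by simp [cb]

theorem cb_succ (k : ℕ) : cb (k + 1) = (2 * k + 1) / (2 * k + 2) * cb k := by
  have h := Nat.succ_mul_centralBinom_succ k
  have h' : ((k : ℝ) + 1) * (k + 1).centralBinom = 2 * (2 * k + 1) * k.centralBinom := by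
    exact_mod_cast h
  have hk : (0 : ℝ) < (k : ℝ) + 1 := by positivity
  rw [cb, cb, pow_succ]
  field_simp
  linarith

theorem cb_pos (k : ℕ) : 0 < cb k :=
  div_pos (Nat.cast_pos.2 k.centralBinom_pos) (by positivity)

theorem cb_antitone : Antitone cb := by
  refine antitone_nat_of_succ_le fun k => ?_
  rw [cb_succ]
  refine mul_le_of_le_one_left (cb_pos k).le ?_
  rw [div_le_one (by positivity)]
  linarith

theorem cb_le_one (k : ℕ) : cb k ≤ 1 := cb_zero ▸ cb_antitone (Nat.zero_le k)

/-- The elementary form of `cb k ≤ (k+1)^(-1/2)`; the induction compares consecutive ratios. -/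
theorem cb_sq_mul_le (k : ℕ) : cb k ^ 2 * (k + 1) ≤ 1 := by
  induction k with
  | zero => simp [cb_zero]
  | succ k ih =>
    refine le_trans ?_ ih
    have h : ((2 * (k : ℝ) + 1) / (2 * k + 2)) ^ 2 * (k + 1 + 1) ≤ k + 1 := by
      rw [div_pow, div_mul_eq_mul_div, div_le_iff₀ (by positivity)]
      have : (0 : ℝ) ≤ k := k.cast_nonneg
      nlinarith [mul_nonneg this this]
    rw [cb_succ, mul_pow]
    push_cast
    nlinarith [mul_le_mul_of_nonneg_left h (sq_nonneg (cb k))]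

/-- The square of the series is the geometric series. By symmetry the convolution weighted by the
first index is half its degree times the convolution, and `(i+1) cb (i+1) = (i+1/2) cb i`; together
they show that `n+1` times the convolution is unchanged from degree `n` to `n+1`. -/
theorem sum_antidiagonal_cb (n : ℕ) :
    ∑ p ∈ Finset.HasAntidiagonal.antidiagonal n, cb p.1 * cb p.2 = 1 := by
  have key : ∀ m : ℕ, 2 * ∑ p ∈ Finset.HasAntidiagonal.antidiagonal m, (p.1 : ℝ) * (cb p.1 * cb p.2) =
      m * ∑ p ∈ Finset.HasAntidiagonal.antidiagonal m, cb p.1 * cb p.2 := by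
    intro m
    rw [two_mul]
    nth_rw 2 [← Finset.Nat.sum_antidiagonal_swap]
    rw [← Finset.sum_add_distrib, Finset.mul_sum]
    refine Finset.sum_congr rfl fun p hp => ?_
    rw [← Finset.HasAntidiagonal.mem_antidiagonal.1 hp]
    simp only [Prod.fst_swap, Prod.snd_swap]
    push_cast
    ring
  induction n with
  | zero => simp [cb_zero]
  | succ n ih =>
    have h1 := key (n + 1)
    have h2 := key n
    rw [Finset.Nat.sum_antidiagonal_succ] at h1
    have h3 : ∀ p : ℕ × ℕ, (((p.1 + 1 : ℕ) : ℝ)) * (cb (p.1 + 1) * cb p.2) =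
        p.1 * (cb p.1 * cb p.2) + 1 / 2 * (cb p.1 * cb p.2) := by
      intro p
      rw [cb_succ]
      have : (0 : ℝ) < (p.1 : ℝ) + 1 := by positivity
      push_cast
      field_simp
    simp_rw [h3, Finset.sum_add_distrib, ← Finset.mul_sum] at h1
    rw [ih] at h1 h2
    have hn : ((n + 1 : ℕ) : ℝ) ≠ 0 := by positivity
    apply mul_left_cancel₀ hn
    rw [← h1]
    push_cast
    linarith

theorem summable_cb {u : ℝ} (h0 : 0 ≤ u) (h1 : u < 1) : Summable fun k => cb k * u ^ k :=
  Summable.of_nonneg_of_le (fun k => mul_nonneg (cb_pos k).le (pow_nonneg h0 k))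
    (fun k => mul_le_of_le_one_left (pow_nonneg h0 k) (cb_le_one k))
    (summable_geometric_of_lt_one h0 h1)

theorem tsum_cb_sq {u : ℝ} (h0 : 0 ≤ u) (h1 : u < 1) :
    (∑' k, cb k * u ^ k) ^ 2 = (1 - u)⁻¹ := by
  have hs : Summable fun k => ‖cb k * u ^ k‖ := (summable_cb h0 h1).norm
  rw [sq, tsum_mul_tsum_eq_tsum_sum_antidiagonal_of_summable_norm hs hs,
    ← tsum_geometric_of_lt_one h0 h1]
  refine tsum_congr fun n => ?_
  have h : ∀ p ∈ Finset.HasAntidiagonal.antidiagonal n, cb p.1 * u ^ p.1 * (cb p.2 * u ^ p.2) =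
      cb p.1 * cb p.2 * u ^ n := by
    intro p hp
    rw [← Finset.HasAntidiagonal.mem_antidiagonal.1 hp, pow_add]
    ring
  rw [Finset.sum_congr rfl h, ← Finset.sum_mul, sum_antidiagonal_cb, one_mul]

/-- The full series `T` satisfies `β T = 1`, since its square is `β⁻²`. As `cb` decreases, the tail
from `q` on is at most `u^q T`. -/
theorem abs_one_sub_mul_sum_cb_le {β : ℝ} (h0 : 0 < β) (h1 : β ≤ 1) (q : ℕ) :
    |1 - β * ∑ k ∈ Finset.range q, cb k * (1 - β ^ 2) ^ k| ≤ (1 - β ^ 2) ^ q := by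
  set u := 1 - β ^ 2 with hu
  have hu0 : 0 ≤ u := by nlinarith
  have hu1 : u < 1 := by nlinarith
  have hs := summable_cb hu0 hu1
  set T := ∑' k, cb k * u ^ k with hT
  have hT0 : 0 ≤ T := tsum_nonneg fun k => mul_nonneg (cb_pos k).le (pow_nonneg hu0 k)
  have hβT : β * T = 1 := by
    have h : (β * T) ^ 2 = 1 := by
      rw [mul_pow, tsum_cb_sq hu0 hu1, hu, sub_sub_cancel]
      exact mul_inv_cancel₀ (by positivity)
    exact (pow_eq_one_iff_of_nonneg (mul_nonneg h0.le hT0) two_ne_zero).1 h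
  have hsplit := hs.sum_add_tsum_nat_add q
  have htail0 : 0 ≤ ∑' k, cb (k + q) * u ^ (k + q) :=
    tsum_nonneg fun k => mul_nonneg (cb_pos _).le (pow_nonneg hu0 _)
  have htail : ∑' k, cb (k + q) * u ^ (k + q) ≤ u ^ q * T := by
    rw [hT, ← tsum_mul_left]
    refine Summable.tsum_le_tsum (fun k => ?_) ((summable_nat_add_iff q).2 hs) (hs.mul_left _)
    have := mul_le_mul_of_nonneg_right (cb_antitone (Nat.le_add_right k q))
      (pow_nonneg hu0 (k + q))
    calc _ ≤ _ := this
      _ = _ := by rw [pow_add]; ring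
  have heq : 1 - β * ∑ k ∈ Finset.range q, cb k * u ^ k =
      β * ∑' k, cb (k + q) * u ^ (k + q) := by
    rw [← hβT, hT, ← hsplit]
    ring
  rw [heq, abs_of_nonneg (mul_nonneg h0.le htail0)]
  calc _ ≤ β * (u ^ q * T) := mul_le_mul_of_nonneg_left htail h0.le
    _ = u ^ q * (β * T) := by ring
    _ = _ := by rw [hβT, mul_one]

/-- From `(1 - β²/2)² (1 + β²) ≤ 1` and Bernoulli's inequality for `(1 + β²)^k`. -/
theorem mul_one_sub_sq_half_pow_le {β : ℝ} (h0 : 0 ≤ β) (h1 : β ≤ 1) (k : ℕ) :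
    (β * (1 - β ^ 2 / 2) ^ k) ^ 2 * (k + 1) ≤ 1 := by
  have hb : 0 ≤ 1 - β ^ 2 / 2 := by nlinarith
  have h2 : ((1 - β ^ 2 / 2) ^ k) ^ 2 * (1 + k * β ^ 2) ≤ 1 := by
    have h3 : 1 + k * β ^ 2 ≤ (1 + β ^ 2) ^ k :=
      one_add_mul_le_pow (by nlinarith) k
    calc _ ≤ ((1 - β ^ 2 / 2) ^ k) ^ 2 * (1 + β ^ 2) ^ k :=
          mul_le_mul_of_nonneg_left h3 (sq_nonneg _)
      _ = ((1 - β ^ 2 / 2) ^ 2 * (1 + β ^ 2)) ^ k := by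
          rw [mul_pow, ← pow_mul, ← pow_mul, mul_comm k 2]
      _ ≤ 1 := by
          refine pow_le_one₀ (by positivity) ?_
          have : β ^ 2 ≤ 1 := by nlinarith
          nlinarith [mul_nonneg (sq_nonneg β) (sq_nonneg β), mul_nonneg (mul_nonneg (sq_nonneg β) (sq_nonneg β)) (sub_nonneg.2 this)]
  have hk : (0 : ℝ) ≤ k := k.cast_nonneg
  have h4 : β ^ 2 * (k + 1) ≤ 1 + k * β ^ 2 := by nlinarith
  calc (β * (1 - β ^ 2 / 2) ^ k) ^ 2 * (k + 1)
      = ((1 - β ^ 2 / 2) ^ k) ^ 2 * (β ^ 2 * (k + 1)) := by ring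
    _ ≤ ((1 - β ^ 2 / 2) ^ k) ^ 2 * (1 + k * β ^ 2) :=
        mul_le_mul_of_nonneg_left h4 (sq_nonneg _)
    _ ≤ 1 := h2

/-- Since `1 - β² ≤ (1 - β²/2)²`, the power splits into two halves. One half, with `β`, is at most
`(k+1)^(-1/2)`, as is `cb k`, which pays for the factor `k+1`; the other half supplies the geometric
decay uniformly in `β ≥ α`. -/
theorem cb_mul_pow_le {α β : ℝ} (hα : 0 ≤ α) (hβ : α ≤ β) (h1 : β ≤ 1) (k : ℕ) :
    cb k * (1 - β ^ 2) ^ k * β * (k + 1) ≤ (1 - α ^ 2 / 2) ^ k := by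
  have h0 : 0 ≤ β := hα.trans hβ
  have hu0 : 0 ≤ 1 - β ^ 2 := by nlinarith
  have hb0 : 0 ≤ 1 - β ^ 2 / 2 := by nlinarith
  set x := cb k with hx
  set z := β * (1 - β ^ 2 / 2) ^ k with hz
  have hz0 : 0 ≤ z := by positivity
  have hxz : x * z * (k + 1) ≤ 1 := by
    have h2 := cb_sq_mul_le k
    have h3 := mul_one_sub_sq_half_pow_le h0 h1 k
    rw [← hx] at h2
    rw [← hz] at h3
    have hk : (0 : ℝ) ≤ (k : ℝ) + 1 := by positivity
    -- `2xz ≤ x² + z²`, and both squares times `k+1` are at most `1`.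
    nlinarith [mul_nonneg hk (sq_nonneg (x - z))]
  have h4 : (1 - β ^ 2) ^ k ≤ (1 - β ^ 2 / 2) ^ k * (1 - β ^ 2 / 2) ^ k := by
    rw [← mul_pow]
    refine pow_le_pow_left₀ hu0 ?_ k
    nlinarith [sq_nonneg (β ^ 2)]
  have h5 : (1 - β ^ 2 / 2) ^ k ≤ (1 - α ^ 2 / 2) ^ k :=
    pow_le_pow_left₀ hb0 (by nlinarith) k
  have hx0 : 0 < x := cb_pos k
  calc x * (1 - β ^ 2) ^ k * β * (k + 1)
      ≤ x * ((1 - β ^ 2 / 2) ^ k * (1 - β ^ 2 / 2) ^ k) * β * (k + 1) := by gcongr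
    _ = x * z * (k + 1) * (1 - β ^ 2 / 2) ^ k := by rw [hz]; ring
    _ ≤ 1 * (1 - β ^ 2 / 2) ^ k := by gcongr
    _ ≤ _ := by rw [one_mul]; exact h5

/-! ### Error recursions -/

/-- An error that contracts by `ρ (2k+1)/(2k+2) + η` in the `k`-th step, and grows by a term of
order `η ρ'ᵏ / (k+1)`, stays of order `η ρ'ᵏ`. -/
theorem error_step {α η D W Y : ℝ} {k : ℕ} (hα0 : 0 ≤ α) (hα1 : α ≤ 1) (hη0 : 0 ≤ η)
    (hη : η ≤ α ^ 2 / 4) (hY : 0 ≤ Y)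
    (hD : D ≤ 2 * η * (1 - α ^ 2 / 2) ^ k * Y)
    (hW : W * (2 * (k + 1)) ≤ (1 - α ^ 2 / 2) ^ k * Y) :
    (2 * k + 1) / (2 * k + 2) * (1 - α ^ 2) * D + η * (W + D) ≤
      2 * η * (1 - α ^ 2 / 2) ^ (k + 1) * Y := by
  have hk : (0 : ℝ) < (k : ℝ) + 1 := by positivity
  set c : ℝ := (2 * k + 1) / (2 * k + 2) with hc
  have hc0 : 0 ≤ c := by positivity
  have hc1 : c = 1 - 1 / (2 * (k + 1)) := by
    rw [hc]
    field_simp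
    ring
  have ha2 : α ^ 2 ≤ 1 := by nlinarith
  set X := (1 - α ^ 2 / 2) ^ k * Y with hX
  have hX0 : 0 ≤ X := mul_nonneg (pow_nonneg (by linarith) _) hY
  have hD' : D ≤ 2 * η * X := by rw [hX]; linarith
  have hW' : W ≤ X / (2 * (k + 1)) := by rwa [le_div_iff₀ (by positivity)]
  have h1 : 0 ≤ c * (1 - α ^ 2) + η := by
    have := mul_nonneg hc0 (sub_nonneg.2 ha2)
    linarith
  have h2 := mul_le_mul_of_nonneg_left hD' h1
  have h3 := mul_le_mul_of_nonneg_left hW' hη0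
  set i : ℝ := 1 / (2 * (k + 1)) with hi
  have hi0 : 0 ≤ i := by positivity
  have hi1 : i ≤ 1 / 2 := by
    rw [hi, div_le_div_iff₀ (by positivity) (by norm_num)]
    have : (0 : ℝ) ≤ k := k.cast_nonneg
    linarith
  have h4 : X / (2 * (k + 1)) = i * X := by rw [hi]; ring
  rw [h4] at h3
  -- The new error contributes `i`, and `c = 1 - i` gives back `2i(1 - α²)`. Together with `2η ≤
  -- α²/2` and `i ≤ 1/2`, the slack between `1 - α²` and `1 - α²/2` covers the rest.
  have h5 : 2 * (c * (1 - α ^ 2) + η) + i ≤ 2 * (1 - α ^ 2 / 2) := by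
    rw [hc1]
    nlinarith
  have h6 := mul_le_mul_of_nonneg_right h5 (mul_nonneg hη0 hX0)
  have h7 : 2 * η * (1 - α ^ 2 / 2) ^ (k + 1) * Y = 2 * (1 - α ^ 2 / 2) * (η * X) := by
    rw [hX, pow_succ (1 - α ^ 2 / 2)]
    ring
  rw [h7]
  linarith

theorem sum_geom_half_le {α : ℝ} (hα0 : 0 < α) (hα1 : α ≤ 1) (q : ℕ) :
    ∑ k ∈ Finset.range q, (1 - α ^ 2 / 2) ^ k ≤ 2 / α ^ 2 := by
  have h0 : 0 ≤ 1 - α ^ 2 / 2 := by nlinarith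
  have h1 : 1 - α ^ 2 / 2 < 1 := by
    have : 0 < α ^ 2 := by positivity
    linarith
  calc _ ≤ ∑' k, (1 - α ^ 2 / 2) ^ k :=
        (summable_geometric_of_lt_one h0 h1).sum_le_tsum _ fun k _ => pow_nonneg h0 k
    _ = _ := by
        rw [tsum_geometric_of_lt_one h0 h1, sub_sub_cancel, inv_div]

/-! ### Matrix-vector products -/

theorem mulE_eq_toEuclideanLin {n d : ℕ} (A : Matrix (Fin n) (Fin d) ℝ) (x : Vec d) :
    mulE A x = Matrix.toEuclideanLin A x := by
  rw [Matrix.toLpLin_apply]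
  rfl

theorem mulE_mul {n m d : ℕ} (A : Matrix (Fin n) (Fin m) ℝ) (B : Matrix (Fin m) (Fin d) ℝ)
    (x : Vec d) : mulE (A * B) x = mulE A (mulE B x) := by
  simp [mulE, Matrix.mulVec_mulVec]

theorem mulE_one {d : ℕ} (x : Vec d) : mulE (1 : Matrix (Fin d) (Fin d) ℝ) x = x := by
  simp [mulE]

theorem mulE_sub {n d : ℕ} (A : Matrix (Fin n) (Fin d) ℝ) (x y : Vec d) :
    mulE A (x - y) = mulE A x - mulE A y := by
  simp_rw [mulE_eq_toEuclideanLin, map_sub]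

theorem inner_eq_dotProduct {d : ℕ} (x y : Vec d) : inner ℝ x y = x.ofLp ⬝ᵥ y.ofLp := by
  rw [EuclideanSpace.inner_eq_star_dotProduct, dotProduct_comm]
  simp

theorem inner_mulE {n d : ℕ} (A : Matrix (Fin n) (Fin d) ℝ) (x : Vec n) (y : Vec d) :
    inner ℝ x (mulE A y) = inner ℝ (mulE Aᵀ x) y := by
  rw [inner_eq_dotProduct, inner_eq_dotProduct]
  simp only [mulE, Matrix.dotProduct_mulVec, Matrix.mulVec_transpose]

theorem mulE_gram {n d : ℕ} (A : Matrix (Fin n) (Fin d) ℝ) (lam : ℝ) (x : Vec d) :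
    mulE (gram A lam) x = mulE Aᵀ (mulE A x) + lam • x := by
  rw [← mulE_mul]
  simp only [mulE, gram, Matrix.add_mulVec, Matrix.smul_mulVec, Matrix.one_mulVec]
  rfl

theorem matNorm_eq {d : ℕ} (M : Matrix (Fin d) (Fin d) ℝ) (x : Vec d) :
    matNorm M x = √(inner ℝ x (mulE M x)) := by
  rw [matNorm, inner_eq_dotProduct]
  rfl

/-! ### Diagonal operators -/

section Diagonal

variable {d : ℕ} (b : OrthonormalBasis (Fin d) ℝ (Vec d))

/-- The operator that multiplies the `i`-th coordinate with respect to `b` by `f i`. -/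
def dOp (f : Fin d → ℝ) (x : Vec d) : Vec d :=
  b.repr.symm (WithLp.toLp 2 fun i => f i * b.repr x i)

@[simp] theorem repr_dOp (f : Fin d → ℝ) (x : Vec d) (i : Fin d) :
    b.repr (dOp b f x) i = f i * b.repr x i := by
  simp [dOp]

variable {b} in
theorem ext_repr {x y : Vec d} (h : ∀ i, b.repr x i = b.repr y i) : x = y :=
  b.repr.injective (PiLp.ext h)

theorem inner_repr (x y : Vec d) : inner ℝ x y = ∑ i, b.repr x i * b.repr y i := by
  rw [← b.repr.inner_map_map, inner_eq_dotProduct]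
  rfl

theorem norm_sq_repr (x : Vec d) : ‖x‖ ^ 2 = ∑ i, b.repr x i ^ 2 := by
  rw [← real_inner_self_eq_norm_sq, inner_repr b]
  simp_rw [sq]

theorem norm_dOp_le {f : Fin d → ℝ} {B : ℝ} (hB : 0 ≤ B) (h : ∀ i, |f i| ≤ B) (x : Vec d) :
    ‖dOp b f x‖ ≤ B * ‖x‖ := by
  refine le_of_sq_le_sq ?_ (mul_nonneg hB (norm_nonneg x))
  rw [mul_pow, norm_sq_repr b, norm_sq_repr b, Finset.mul_sum]
  refine Finset.sum_le_sum fun i _ => ?_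
  rw [repr_dOp, mul_pow, ← sq_abs (f i)]
  exact mul_le_mul_of_nonneg_right (pow_le_pow_left₀ (abs_nonneg _) (h i) 2) (sq_nonneg _)

theorem repr_apply_of_eigen (T : Vec d →ₗ[ℝ] Vec d) {f : Fin d → ℝ}
    (h : ∀ i, T (b i) = f i • b i) (x : Vec d) (i : Fin d) :
    b.repr (T x) i = f i * b.repr x i := by
  conv_lhs => rw [← b.sum_repr x]
  simp only [map_sum, map_smul, h]
  simp [Finset.sum_apply, Pi.single_apply, mul_comm]

end Diagonal

/-! ### The eigenbasis of `Aᵀ A` -/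

section Spectral

variable {n d : ℕ} (A : Matrix (Fin n) (Fin d) ℝ) {lam : ℝ}

/-- Right singular vectors of `A`. -/
def eigB : OrthonormalBasis (Fin d) ℝ (Vec d) :=
  (Matrix.toEuclideanLin A).isSymmetric_adjoint_comp_self.eigenvectorBasis finrank_euclideanSpace_fin

/-- The eigenvalues `σ_i(A)²` of `Aᵀ A`. -/
def ev (i : Fin d) : ℝ := sigma A (i + 1) ^ 2

theorem ev_nonneg (i : Fin d) : 0 ≤ ev A i := sq_nonneg _

theorem sigma_nonneg (i : ℕ) : 0 ≤ sigma A i := LinearMap.singularValues_nonneg _ _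

theorem sigma_anti {i j : ℕ} (h : i ≤ j) : sigma A j ≤ sigma A i :=
  (Matrix.toEuclideanLin A).singularValues_antitone (Nat.sub_le_sub_right h 1)

theorem ev_le (i : Fin d) : ev A i ≤ sigma A 1 ^ 2 :=
  pow_le_pow_left₀ (sigma_nonneg A _) (sigma_anti A (Nat.le_add_left _ _)) 2

theorem mulE_gram_eigB (i : Fin d) : mulE (Aᵀ * A) (eigB A i) = ev A i • eigB A i := by
  have h := (Matrix.toEuclideanLin A).isSymmetric_adjoint_comp_self.apply_eigenvectorBasis
    finrank_euclideanSpace_fin i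
  have h2 := (Matrix.toEuclideanLin A).sq_singularValues_fin (finrank_euclideanSpace_fin (𝕜 := ℝ)) i
  rw [mulE_mul, mulE_eq_toEuclideanLin, mulE_eq_toEuclideanLin,
    ← Matrix.conjTranspose_eq_transpose_of_trivial, Matrix.toEuclideanLin_conjTranspose_eq_adjoint]
  refine h.trans ?_
  rw [← h2]
  rfl

theorem repr_mulE_mulE (x : Vec d) (i : Fin d) :
    (eigB A).repr (mulE Aᵀ (mulE A x)) i = ev A i * (eigB A).repr x i := by
  rw [← mulE_mul, mulE_eq_toEuclideanLin]
  refine repr_apply_of_eigen (eigB A) _ (fun i => ?_) x i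
  rw [← mulE_eq_toEuclideanLin, mulE_gram_eigB]

theorem repr_mulE_gram (x : Vec d) (i : Fin d) :
    (eigB A).repr (mulE (gram A lam) x) i = (ev A i + lam) * (eigB A).repr x i := by
  rw [mulE_gram, map_add, map_smul, PiLp.add_apply, PiLp.smul_apply, repr_mulE_mulE]
  simp only [smul_eq_mul]
  ring

theorem mulE_gram_mulE_inv (hlam : 0 < lam) (x : Vec d) : mulE (gram A lam) (mulE (gram A lam)⁻¹ x) = x := by
  have hu : IsUnit (gram A lam) := by
    rw [← Matrix.mulVec_injective_iff_isUnit]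
    intro v w hvw
    have h : mulE (gram A lam) (WithLp.toLp 2 v) = mulE (gram A lam) (WithLp.toLp 2 w) :=
      congrArg (WithLp.toLp 2) hvw
    have h2 : WithLp.toLp 2 v = (WithLp.toLp 2 w : Vec d) := by
      refine ext_repr (b := eigB A) fun i => ?_
      have h3 := congrArg (fun z => (eigB A).repr z i) h
      simp only [repr_mulE_gram] at h3
      exact mul_left_cancel₀ (by have := ev_nonneg A i; positivity) h3
    exact (WithLp.toLp_injective 2) h2
  rw [← mulE_mul, Matrix.mul_nonsing_inv _ ((Matrix.isUnit_iff_isUnit_det _).1 hu), mulE_one]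

theorem repr_mulE_gram_inv (hlam : 0 < lam) (x : Vec d) (i : Fin d) :
    (eigB A).repr (mulE (gram A lam)⁻¹ x) i = (eigB A).repr x i / (ev A i + lam) := by
  have h := repr_mulE_gram A (lam := lam) (mulE (gram A lam)⁻¹ x) i
  rw [mulE_gram_mulE_inv A hlam] at h
  have := ev_nonneg A i
  rw [h]
  field_simp

/-- The spectrum is finite, so `f` agrees on it with an interpolation polynomial, and for
polynomials the claim is algebra. -/
theorem mulE_cfc_of_eigen {M : Matrix (Fin d) (Fin d) ℝ} (hM : M.IsHermitian) (f : ℝ → ℝ)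
    {x : Vec d} {μ : ℝ} (hx : mulE M x = μ • x) : mulE (cfc f M) x = f μ • x := by
  classical
  by_cases h0 : x = 0
  · simp [h0, mulE]
  have hfin : (spectrum ℝ M).Finite := Matrix.finite_real_spectrum
  set p := Lagrange.interpolate hfin.toFinset id f with hp
  have hpf : ∀ t ∈ spectrum ℝ M, f t = p.eval t := by
    intro t ht
    exact (Lagrange.eval_interpolate_at_node f (Set.injOn_id _) (hfin.mem_toFinset.2 ht)).symm
  have hsa : IsSelfAdjoint M := hM
  have hvec : M.mulVec x.ofLp = μ • x.ofLp := congrArg WithLp.ofLp hx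
  have hmem : μ ∈ spectrum ℝ M := by
    rw [← Matrix.spectrum_toLin']
    refine Module.End.HasEigenvalue.mem_spectrum
      (Module.End.hasEigenvalue_of_hasEigenvector (x := x.ofLp) ⟨?_, ?_⟩)
    · rw [Module.End.mem_eigenspace_iff, Matrix.toLin'_apply, hvec]
    · intro h
      exact h0 (WithLp.ofLp_injective 2 h)
  have hcfc : cfc f M = Polynomial.aeval M p := by
    rw [cfc_congr (g := p.eval) hpf, cfc_polynomial p M hsa]
  rw [hcfc, hpf μ hmem]
  have : ∀ r : Polynomial ℝ, mulE (Polynomial.aeval M r) x = r.eval μ • x := by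
    intro r
    induction r using Polynomial.induction_on' with
    | add p q hp hq =>
      rw [map_add, Polynomial.eval_add, add_smul, ← hp, ← hq]
      simp [mulE, Matrix.add_mulVec]
    | monomial k a =>
      rw [Polynomial.aeval_monomial, Polynomial.eval_monomial]
      have hpow : ∀ k : ℕ, mulE (M ^ k) x = μ ^ k • x := by
        intro k
        induction k with
        | zero => simp [mulE_one]
        | succ k ih =>
          rw [pow_succ, mulE_mul, hx, mulE_eq_toEuclideanLin, map_smul, ← mulE_eq_toEuclideanLin,
            ih, smul_smul, pow_succ, mul_comm]
      rw [mul_smul, ← hpow, Algebra.algebraMap_eq_smul_one, smul_mul_assoc, one_mul]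
      simp [mulE, Matrix.smul_mulVec]
  exact this p

theorem repr_mulE_topProj (x : Vec d) (i : Fin d) :
    (eigB A).repr (mulE (topProj A lam) x) i =
      (if lam ≤ ev A i then 1 else 0) * (eigB A).repr x i := by
  rw [mulE_eq_toEuclideanLin]
  refine repr_apply_of_eigen (eigB A) (Matrix.toEuclideanLin (topProj A lam))
    (f := fun i => if lam ≤ ev A i then 1 else 0) (fun i => ?_) x i
  rw [← mulE_eq_toEuclideanLin]
  have hM : (Aᵀ * A).IsHermitian := by
    rw [← Matrix.conjTranspose_eq_transpose_of_trivial]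
    exact Matrix.isHermitian_conjTranspose_mul_self A
  exact mulE_cfc_of_eigen hM _ (mulE_gram_eigB A i)

/-! ### The quadratic form of the regularized Gram matrix -/

theorem inner_mulE_gram (x y : Vec d) :
    inner ℝ x (mulE (gram A lam) y) = inner ℝ (mulE A x) (mulE A y) + lam * inner ℝ x y := by
  rw [mulE_gram, inner_add_right, inner_smul_right, inner_mulE, Matrix.transpose_transpose]

theorem norm_mulE_sq_le (x : Vec d) : ‖mulE A x‖ ^ 2 ≤ sigma A 1 ^ 2 * ‖x‖ ^ 2 := by
  have h : ‖mulE A x‖ ^ 2 = inner ℝ x (mulE Aᵀ (mulE A x)) := by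
    rw [inner_mulE, Matrix.transpose_transpose, real_inner_self_eq_norm_sq]
  rw [h, inner_repr (eigB A), norm_sq_repr (eigB A), Finset.mul_sum]
  refine Finset.sum_le_sum fun i _ => ?_
  rw [repr_mulE_mulE]
  have := mul_le_mul_of_nonneg_right (ev_le A i) (sq_nonneg ((eigB A).repr x i))
  linarith

/-- `‖x‖²` in the norm given by `Aᵀ A + λ I`. -/
def gramSq (lam : ℝ) (x : Vec d) : ℝ := ‖mulE A x‖ ^ 2 + lam * ‖x‖ ^ 2

theorem gramSq_eq_inner (x : Vec d) : gramSq A lam x = inner ℝ x (mulE (gram A lam) x) := by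
  rw [inner_mulE_gram, real_inner_self_eq_norm_sq, real_inner_self_eq_norm_sq, gramSq]

theorem gramSq_le (x : Vec d) : gramSq A lam x ≤ (sigma A 1 ^ 2 + lam) * ‖x‖ ^ 2 := by
  have := norm_mulE_sq_le A x
  rw [gramSq]
  linarith

theorem gramSq_nonneg (hlam : 0 < lam) (x : Vec d) : 0 ≤ gramSq A lam x := by
  rw [gramSq]
  positivity

theorem le_gramSq (x : Vec d) : lam * ‖x‖ ^ 2 ≤ gramSq A lam x := by
  rw [gramSq]
  linarith [sq_nonneg ‖mulE A x‖]

/-- Rests on `‖y‖_{H⁻¹} = ‖H⁻¹ y‖_H`, which removes the inverse norm from the accuracy criterion. -/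
theorem ridgeApprox_iff (hlam : 0 < lam) (y z : Vec d) {ε : ℝ} (hε : 0 ≤ ε) :
    RidgeApprox A lam y ε z ↔
      gramSq A lam (z - mulE (gram A lam)⁻¹ y) ≤
        ε ^ 2 * gramSq A lam (mulE (gram A lam)⁻¹ y) := by
  have h : inner ℝ y (mulE (gram A lam)⁻¹ y) = gramSq A lam (mulE (gram A lam)⁻¹ y) := by
    rw [gramSq_eq_inner, mulE_gram_mulE_inv A hlam, real_inner_comm]
  rw [RidgeApprox, matNorm_eq, matNorm_eq, h, ← gramSq_eq_inner]
  rw [Real.sqrt_le_left (mul_nonneg hε (Real.sqrt_nonneg _)), mul_pow,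
    Real.sq_sqrt (gramSq_nonneg A hlam _)]

/-- An approximate solution of the ridge regression problem with right hand side `Aᵀ A x`
approximates the solution in the Euclidean norm. -/
theorem norm_sub_le_of_ridgeApprox (hlam : 0 < lam) {x z : Vec d} {ε : ℝ} (hε : 0 ≤ ε)
    (h : RidgeApprox A lam (mulE Aᵀ (mulE A x)) ε z) :
    ‖z - dOp (eigB A) (fun i => ev A i / (ev A i + lam)) x‖ ≤ ε * √(kappa A lam) * ‖x‖ := by
  have hR : mulE (gram A lam)⁻¹ (mulE Aᵀ (mulE A x)) =
      dOp (eigB A) (fun i => ev A i / (ev A i + lam)) x := by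
    refine ext_repr (b := eigB A) fun i => ?_
    rw [repr_mulE_gram_inv A hlam, repr_mulE_mulE, repr_dOp]
    ring
  rw [ridgeApprox_iff A hlam _ _ hε, hR] at h
  set R := dOp (eigB A) (fun i => ev A i / (ev A i + lam)) x with hRdef
  -- On an eigenvector this is `m²/(m+λ) ≤ m ≤ σ_1²`. Passing back to the Euclidean norm divides by
  -- `λ`, whence the factor `√κ`.
  have h1 : gramSq A lam R ≤ sigma A 1 ^ 2 * ‖x‖ ^ 2 := by
    rw [gramSq_eq_inner, inner_repr (eigB A), norm_sq_repr (eigB A), Finset.mul_sum]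
    refine Finset.sum_le_sum fun i _ => ?_
    rw [repr_mulE_gram, hRdef, repr_dOp]
    have h0 := ev_nonneg A i
    have h2 := ev_le A i
    have h3 : ev A i / (ev A i + lam) * (ev A i + lam) * (ev A i / (ev A i + lam)) ≤ ev A i := by
      rw [div_mul_cancel₀ _ (by positivity)]
      refine mul_le_of_le_one_right h0 ?_
      rw [div_le_one (by positivity)]
      linarith
    have h4 := mul_le_mul_of_nonneg_right (h3.trans h2) (sq_nonneg ((eigB A).repr x i))
    calc _ = _ := by ring
      _ ≤ _ := h4
  refine le_of_sq_le_sq ?_ (by positivity)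
  have h5 := le_gramSq A (lam := lam) (z - R)
  have h6 : lam * ‖z - R‖ ^ 2 ≤ ε ^ 2 * (sigma A 1 ^ 2 * ‖x‖ ^ 2) :=
    h5.trans (h.trans (mul_le_mul_of_nonneg_left h1 (sq_nonneg _)))
  rw [mul_pow, mul_pow, Real.sq_sqrt (by rw [kappa]; positivity), kappa]
  rw [mul_comm lam, ← le_div_iff₀ hlam] at h6
  calc _ ≤ _ := h6
    _ = _ := by ring

end Spectral

/-! ### Accuracy of the main loop -/

section Loop

variable {d : ℕ} (b : OrthonormalBasis (Fin d) ℝ (Vec d)) (r : Fin d → ℝ)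

/-- The value of `w` after `k` exact passes of the main loop. -/
def exactW (y : Vec d) (k : ℕ) : Vec d :=
  dOp b (fun i => cb k * (1 - (2 * r i - 1) ^ 2) ^ k * (r i - 1 / 2)) y

/-- The value of `s` after `k` exact passes of the main loop. -/
def exactS (y : Vec d) (k : ℕ) : Vec d :=
  dOp b (fun i => 1 / 2 + (r i - 1 / 2) *
    ∑ j ∈ Finset.range (k + 1), cb j * (1 - (2 * r i - 1) ^ 2) ^ j) y

theorem exactS_succ (y : Vec d) (k : ℕ) :
    exactS b r y (k + 1) = exactS b r y k + exactW b r y (k + 1) := by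
  refine ext_repr (b := b) fun i => ?_
  simp only [exactS, exactW, repr_dOp, map_add, PiLp.add_apply]
  rw [Finset.sum_range_succ]
  ring

variable {r} {α : ℝ}

/-- Error bounds maintained by the main loop. -/
def LoopInv (r : Fin d → ℝ) (α η : ℝ) (y : Vec d) (k : ℕ) (st : Vec d × Vec d) : Prop :=
  ‖st.2 - exactW b r y k‖ ≤ 2 * η * (1 - α ^ 2 / 2) ^ k * ‖y‖ ∧
    ‖st.1 - exactS b r y k‖ ≤
      2 * η * (∑ j ∈ Finset.range (k + 1), (1 - α ^ 2 / 2) ^ j) * ‖y‖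

/-- `cb_mul_pow_le` with `β = |2r - 1|`; the extra `2` comes from `r - 1/2 = (2r - 1)/2`. -/
theorem norm_exactW_le (hα0 : 0 < α) (hα1 : α ≤ 1)
    (hr : ∀ i, α ≤ |2 * r i - 1| ∧ |2 * r i - 1| ≤ 1)
    (y : Vec d) (k : ℕ) :
    ‖exactW b r y k‖ * (2 * (k + 1)) ≤ (1 - α ^ 2 / 2) ^ k * ‖y‖ := by
  have hk : (0 : ℝ) < 2 * ((k : ℝ) + 1) := by positivity
  have hρ : 0 ≤ (1 - α ^ 2 / 2) ^ k := pow_nonneg (by nlinarith) _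
  rw [← le_div_iff₀ hk, mul_div_right_comm]
  refine norm_dOp_le b (by positivity) (fun i => ?_) y
  have h := cb_mul_pow_le hα0.le (hr i).1 (hr i).2 k
  have h1 : 0 ≤ 1 - (2 * r i - 1) ^ 2 := by
    rw [← sq_abs]
    nlinarith [(hr i).2, abs_nonneg (2 * r i - 1)]
  rw [le_div_iff₀ hk, abs_mul, abs_mul, abs_of_pos (cb_pos k), abs_of_nonneg (pow_nonneg h1 k)]
  have h2 : |r i - 1 / 2| = |2 * r i - 1| / 2 := by
    rw [← abs_of_pos (two_pos (α := ℝ)), ← abs_div, abs_of_pos (two_pos (α := ℝ))]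
    congr 1
    ring
  rw [h2]
  rw [sq_abs] at h
  linarith

/-- The exact pass multiplies by `4r(1-r) = 1 - (2r-1)²` and so contracts the old error by `1 - α²`.
The second call adds at most `4e‖w - v‖ ≤ 8e‖w‖`; the error of the first passes through an operator
of norm at most `1` and adds `4e‖w‖`. Their total `12e` is the `η` of `error_step`. -/
theorem loop_step (hα0 : 0 < α) (hα1 : α ≤ 1)
    (hr : ∀ i, α ≤ |2 * r i - 1| ∧ |2 * r i - 1| ≤ 1)
    {e : ℝ} (he0 : 0 ≤ e) (he : 12 * e ≤ α ^ 2 / 4) {y : Vec d} {k : ℕ}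
    {s w v u : Vec d} (hI : LoopInv b r α (12 * e) y k (s, w))
    (hv : ‖v - dOp b r w‖ ≤ e * ‖w‖) (hu : ‖u - dOp b r (w - v)‖ ≤ e * ‖w - v‖) :
    LoopInv b r α (12 * e) y (k + 1)
      (s + (4 * ((2 * (k : ℝ) + 1) / (2 * (k : ℝ) + 2))) • u,
        (4 * ((2 * (k : ℝ) + 1) / (2 * (k : ℝ) + 2))) • u) := by
  obtain ⟨hw, hs⟩ := hI
  have hWx := norm_exactW_le b hα0 hα1 hr y k
  set c : ℝ := (2 * (k : ℝ) + 1) / (2 * (k : ℝ) + 2) with hc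
  have hc0 : 0 ≤ c := by positivity
  have hc1 : c ≤ 1 := by
    rw [hc, div_le_one (by positivity)]
    linarith
  have he1 : e ≤ 1 := by nlinarith
  have hr01 : ∀ i, 0 ≤ r i ∧ r i ≤ 1 := fun i => by
    have := abs_le.1 (hr i).2
    constructor <;> linarith
  -- the exact step applied to the current vector
  have hdecomp : (4 * c) • u - exactW b r y (k + 1) =
      (4 * c) • (u - dOp b r (w - v)) + (4 * c) • dOp b r (dOp b r w - v) +
        c • dOp b (fun i => 1 - (2 * r i - 1) ^ 2) (w - exactW b r y k) := by
    refine ext_repr (b := b) fun i => ?_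
    simp only [exactW, repr_dOp, map_add, map_sub, map_smul, PiLp.add_apply, PiLp.sub_apply,
      PiLp.smul_apply, smul_eq_mul, cb_succ, pow_succ (1 - (2 * r i - 1) ^ 2), ← hc]
    ring
  have hRn : ∀ x, ‖dOp b r x‖ ≤ 1 * ‖x‖ := norm_dOp_le b zero_le_one fun i => by
    rw [abs_of_nonneg (hr01 i).1]
    exact (hr01 i).2
  have hwv : ‖w - v‖ ≤ (1 + e) * ‖w‖ := by
    have h1 : w - v = dOp b (fun i => 1 - r i) w - (v - dOp b r w) := by
      refine ext_repr (b := b) fun i => ?_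
      simp only [repr_dOp, map_sub, PiLp.sub_apply]
      ring
    have h2 : ‖dOp b (fun i => 1 - r i) w‖ ≤ 1 * ‖w‖ := norm_dOp_le b zero_le_one (fun i => by
      rw [abs_of_nonneg (sub_nonneg.2 (hr01 i).2)]
      linarith [(hr01 i).1]) w
    rw [h1]
    linarith [norm_sub_le (dOp b (fun i => 1 - r i) w) (v - dOp b r w)]
  have h1 : ‖(4 * c) • (u - dOp b r (w - v))‖ ≤ 8 * e * ‖w‖ := by
    rw [norm_smul, Real.norm_of_nonneg (by positivity)]
    have h2 : ‖u - dOp b r (w - v)‖ ≤ e * (2 * ‖w‖) := hu.trans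
      (mul_le_mul_of_nonneg_left (hwv.trans
        (mul_le_mul_of_nonneg_right (by linarith) (norm_nonneg w))) he0)
    calc 4 * c * ‖u - dOp b r (w - v)‖ ≤ 4 * 1 * (e * (2 * ‖w‖)) := by gcongr
      _ = _ := by ring
  have h2 : ‖(4 * c) • dOp b r (dOp b r w - v)‖ ≤ 4 * e * ‖w‖ := by
    rw [norm_smul, Real.norm_of_nonneg (by positivity)]
    calc 4 * c * ‖dOp b r (dOp b r w - v)‖ ≤ 4 * 1 * (e * ‖w‖) := by
          gcongr
          exact (by simpa [norm_sub_rev] using hRn (dOp b r w - v) :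
            ‖dOp b r (dOp b r w - v)‖ ≤ ‖v - dOp b r w‖).trans hv
      _ = _ := by ring
  have h3 : ‖c • dOp b (fun i => 1 - (2 * r i - 1) ^ 2) (w - exactW b r y k)‖ ≤
      c * (1 - α ^ 2) * ‖w - exactW b r y k‖ := by
    rw [norm_smul, Real.norm_of_nonneg hc0, mul_assoc]
    refine mul_le_mul_of_nonneg_left (norm_dOp_le b (by nlinarith) (fun i => ?_) _) hc0
    have h4 := pow_le_pow_left₀ hα0.le (hr i).1 2
    have h5 := pow_le_pow_left₀ (abs_nonneg _) (hr i).2 2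
    rw [sq_abs] at h4 h5
    rw [abs_of_nonneg (by linarith)]
    linarith
  have hwn : ‖w‖ ≤ ‖exactW b r y k‖ + ‖w - exactW b r y k‖ := by
    simpa using norm_add_le (exactW b r y k) (w - exactW b r y k)
  have hstep := error_step (Y := ‖y‖) hα0.le hα1 (by positivity : 0 ≤ 12 * e) he (norm_nonneg y)
    hw hWx
  have hnew : ‖(4 * c) • u - exactW b r y (k + 1)‖ ≤
      2 * (12 * e) * (1 - α ^ 2 / 2) ^ (k + 1) * ‖y‖ := by
    refine le_trans ?_ hstep
    rw [hdecomp]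
    have h4 := norm_add₃_le (a := (4 * c) • (u - dOp b r (w - v)))
      (b := (4 * c) • dOp b r (dOp b r w - v))
      (c := c • dOp b (fun i => 1 - (2 * r i - 1) ^ 2) (w - exactW b r y k))
    have h5 := mul_le_mul_of_nonneg_left hwn he0
    simp only [← hc]
    linarith
  refine ⟨hnew, ?_⟩
  have h6 : s + (4 * c) • u - exactS b r y (k + 1) =
      (s - exactS b r y k) + ((4 * c) • u - exactW b r y (k + 1)) := by
    rw [exactS_succ]
    abel
  simp only
  rw [h6, Finset.sum_range_succ]
  refine (norm_add_le _ _).trans ((add_le_add hs hnew).trans (le_of_eq ?_))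
  ring

theorem fail_pcLoop_le (hα0 : 0 < α) (hα1 : α ≤ 1)
    (hr : ∀ i, α ≤ |2 * r i - 1| ∧ |2 * r i - 1| ≤ 1)
    {e : ℝ} (he0 : 0 ≤ e) (he : 12 * e ≤ α ^ 2 / 4) {y : Vec d}
    {R : Vec d → Comp (Vec d)} {D : ℝ≥0∞}
    (hR : ∀ x, fail (R x) (fun v => ‖v - dOp b r x‖ ≤ e * ‖x‖) ≤ D) {s w : Vec d}
    (h0 : LoopInv b r α (12 * e) y 0 (s, w)) (k : ℕ) :
    fail (pcLoop R s w k) (LoopInv b r α (12 * e) y k) ≤ (2 * k : ℕ) * D := by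
  induction k with
  | zero =>
    rw [pcLoop, fail_pure h0]
    exact bot_le
  | succ k ih =>
    rw [pcLoop]
    have h : ((2 * (k + 1) : ℕ) : ℝ≥0∞) * D = (2 * k : ℕ) * D + (D + D) := by
      push_cast
      ring
    rw [h]
    refine fail_bind_le ih fun st hst => ?_
    refine fail_bind_le (hR st.2) fun v hv => ?_
    rw [vsub, fail_exec_bind, ← add_zero D]
    refine fail_bind_le (hR _) fun u hu => ?_
    rw [fail_exec_bind, vscale, fail_exec_bind, vadd, fail_exec_bind, fail_pure]
    exact loop_step b hα0 hα1 hr he0 he hst hv hu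

/-- The step is `(1 + sgn β)/2` with `β = 2r - 1`, so the error is half that of the truncated series
for the sign, which is odd in `β`. -/
theorem norm_exactS_sub_le (hα0 : 0 < α) (hα1 : α ≤ 1)
    (hr : ∀ i, α ≤ |2 * r i - 1| ∧ |2 * r i - 1| ≤ 1)
    (y : Vec d) (q : ℕ) :
    ‖exactS b r y q - dOp b (fun i => if 1 / 2 ≤ r i then 1 else 0) y‖ ≤
      1 / 2 * (1 - α ^ 2) ^ (q + 1) * ‖y‖ := by
  have hsub : exactS b r y q - dOp b (fun i => if 1 / 2 ≤ r i then 1 else 0) y =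
      dOp b (fun i => 1 / 2 + (r i - 1 / 2) *
        ∑ j ∈ Finset.range (q + 1), cb j * (1 - (2 * r i - 1) ^ 2) ^ j -
          if 1 / 2 ≤ r i then 1 else 0) y := by
    refine ext_repr (b := b) fun i => ?_
    simp only [exactS, repr_dOp, map_sub, PiLp.sub_apply]
    ring
  rw [hsub]
  refine norm_dOp_le b (mul_nonneg (by norm_num) (pow_nonneg (by nlinarith) _)) (fun i => ?_) y
  have h := abs_one_sub_mul_sum_cb_le (hα0.trans_le (hr i).1) (hr i).2 (q + 1)
  have h4 := pow_le_pow_left₀ hα0.le (hr i).1 2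
  have h5 := pow_le_pow_left₀ (abs_nonneg _) (hr i).2 2
  have h6 : (1 - |2 * r i - 1| ^ 2) ^ (q + 1) ≤ (1 - α ^ 2) ^ (q + 1) :=
    pow_le_pow_left₀ (by linarith) (by linarith) _
  rw [sq_abs] at h h6
  set S := ∑ j ∈ Finset.range (q + 1), cb j * (1 - (2 * r i - 1) ^ 2) ^ j
  have h7 : |1 / 2 + (r i - 1 / 2) * S - if 1 / 2 ≤ r i then 1 else 0| =
      1 / 2 * |1 - |2 * r i - 1| * S| := by
    rw [← abs_of_pos (one_half_pos (α := ℝ)), ← abs_mul, abs_of_pos (one_half_pos (α := ℝ))]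
    split_ifs with hi
    · rw [abs_of_nonneg (a := 2 * r i - 1) (by linarith), ← abs_neg]
      congr 1
      ring
    · rw [abs_of_neg (a := 2 * r i - 1) (by linarith [not_le.1 hi])]
      congr 1
      ring
  rw [h7]
  linarith

end Loop

/-! ### Accuracy of `pcProj` -/

section Accuracy

variable {n d : ℕ} {A : Matrix (Fin n) (Fin d) ℝ} {lam γ : ℝ} {k : ℕ}

/-- Index shift: `ev A i` is `σ_{i+1}²`, so `i < k` places it above the gap and `i ≥ k` below. -/
theorem sq_sigma_gap (hγ : γ < 1 / 4)
    (h1 : 1 / (1 - 4 * γ) * sigma A (k + 1) ^ 2 ≤ lam) (h2 : lam ≤ (1 - 4 * γ) * sigma A k ^ 2)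
    (i : Fin d) : ev A i ≤ (1 - 4 * γ) * lam ∨ lam ≤ (1 - 4 * γ) * ev A i := by
  have hg : 0 < 1 - 4 * γ := by linarith
  rcases lt_or_ge (i : ℕ) k with hi | hi
  · right
    refine h2.trans (mul_le_mul_of_nonneg_left ?_ hg.le)
    exact pow_le_pow_left₀ (sigma_nonneg A _) (sigma_anti A hi) 2
  · left
    have h3 : ev A i ≤ sigma A (k + 1) ^ 2 :=
      pow_le_pow_left₀ (sigma_nonneg A _) (sigma_anti A (Nat.succ_le_succ hi)) 2
    rw [one_div, inv_mul_le_iff₀ hg] at h1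
    exact h3.trans h1

theorem abs_two_mul_div_sub_one {m : ℝ} (hm : 0 ≤ m) (hlam : 0 < lam) (hγ0 : 0 < γ)
    (hγ : γ < 1 / 4) (h : m ≤ (1 - 4 * γ) * lam ∨ lam ≤ (1 - 4 * γ) * m) :
    (2 * γ ≤ |2 * (m / (m + lam)) - 1| ∧ |2 * (m / (m + lam)) - 1| ≤ 1) ∧
      (1 / 2 ≤ m / (m + lam) ↔ lam ≤ m) := by
  have hp : 0 < m + lam := by positivity
  have h1 : 2 * (m / (m + lam)) - 1 = (m - lam) / (m + lam) := by
    field_simp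
    ring
  refine ⟨?_, ?_⟩
  · rw [h1, abs_div, abs_of_pos hp, le_div_iff₀ hp, div_le_one hp]
    rcases h with h | h
    · have h2 := mul_le_mul_of_nonneg_left h (by linarith : 0 ≤ 1 + 2 * γ)
      have h3 : 0 ≤ γ ^ 2 * lam := by positivity
      rw [abs_of_nonpos (by nlinarith)]
      constructor <;> linarith
    · have h2 := mul_le_mul_of_nonneg_left h (by linarith : 0 ≤ 1 + 2 * γ)
      have h3 : 0 ≤ γ ^ 2 * m := by positivity
      rw [abs_of_nonneg (by nlinarith)]
      constructor <;> linarith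
  · rw [div_le_div_iff₀ two_pos hp]
    constructor <;> intro <;> linarith

variable {c₁ c₂ ε δ : ℝ} {y : Vec d}

theorem fail_softProj_le (hlam : 0 < lam) {ε' δ' : ℝ} (hε : 0 ≤ ε') {ridge : RidgeProc n d}
    {D : ℝ≥0∞} (h : ∀ z, fail (ridge A lam z ε' δ') (RidgeApprox A lam z ε') ≤ D) (x : Vec d) :
    fail (softProj ridge A lam ε' δ' x)
      (fun v => ‖v - dOp (eigB A) (fun i => ev A i / (ev A i + lam)) x‖ ≤
        ε' * √(kappa A lam) * ‖x‖) ≤ D := by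
  have h1 : fail (softProj ridge A lam ε' δ' x)
      (fun v => ‖v - dOp (eigB A) (fun i => ev A i / (ev A i + lam)) x‖ ≤
        ε' * √(kappa A lam) * ‖x‖) =
      fail (ridge A lam (mulE Aᵀ (mulE A x)) ε' δ')
        (fun v => ‖v - dOp (eigB A) (fun i => ev A i / (ev A i + lam)) x‖ ≤
        ε' * √(kappa A lam) * ‖x‖) := by
    simp [softProj, gramVec, matVec, fail]
  rw [h1]
  exact (fail_mono _ fun v hv => norm_sub_le_of_ridgeApprox A hlam hε hv).trans (h _)

/-- `(1 - 4γ²)^q ≤ exp(-4γ² q) ≤ ε^(4c₁)`. -/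
theorem exp_iters_le (hc₁ : 1 / 4 ≤ c₁) (hε0 : 0 < ε) (hε1 : ε < 1) (hγ0 : 0 < γ)
    (hγ : γ < 1 / 4) : (1 - (2 * γ) ^ 2) ^ (iters c₁ ε γ + 1) ≤ ε := by
  have h0 : 0 ≤ 1 - (2 * γ) ^ 2 := by nlinarith
  have h1 : 1 - (2 * γ) ^ 2 ≤ 1 := by nlinarith
  have hL : 0 < Real.log (1 / ε) := Real.log_pos (by rw [lt_div_iff₀ hε0]; linarith)
  have hq : c₁ * γ⁻¹ ^ 2 * Real.log (1 / ε) ≤ iters c₁ ε γ := Nat.le_ceil _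
  calc (1 - (2 * γ) ^ 2) ^ (iters c₁ ε γ + 1) ≤ (1 - (2 * γ) ^ 2) ^ iters c₁ ε γ :=
        pow_le_pow_of_le_one h0 h1 (Nat.le_succ _)
    _ ≤ (Real.exp (-(2 * γ) ^ 2)) ^ iters c₁ ε γ :=
        pow_le_pow_left₀ h0 (by linarith [Real.add_one_le_exp (-(2 * γ) ^ 2)]) _
    _ = Real.exp (-(iters c₁ ε γ * (4 * γ ^ 2))) := by
        rw [← Real.exp_nat_mul]
        congr 1
        ring
    _ ≤ Real.exp (Real.log ε) := by
        refine Real.exp_le_exp.2 ?_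
        have h2 : γ⁻¹ ^ 2 * γ ^ 2 = 1 := by
          rw [← mul_pow, inv_mul_cancel₀ hγ0.ne', one_pow]
        have h3 : c₁ * γ⁻¹ ^ 2 * Real.log (1 / ε) * (4 * γ ^ 2) = 4 * c₁ * Real.log (1 / ε) := by
          calc _ = 4 * c₁ * Real.log (1 / ε) * (γ⁻¹ ^ 2 * γ ^ 2) := by ring
            _ = _ := by rw [h2, mul_one]
        have h4 := mul_le_mul_of_nonneg_right hq (by positivity : 0 ≤ 4 * γ ^ 2)
        rw [h3] at h4
        have h5 : Real.log (1 / ε) = -Real.log ε := by rw [one_div, Real.log_inv]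
        nlinarith
    _ = ε := Real.exp_log hε0

/-- Error budget: `ε/2` for truncating the series and `ε/2` for inexact calls. Keeping the failure
bound `D` abstract lets one statement serve the randomized solvers (`D = δ'`) and the sure ones (`D
= 0`). -/
theorem fail_pcProj_le (hc₁ : 24 ≤ c₁) (hc₂ : 24 ≤ c₂) (hε0 : 0 < ε) (hε1 : ε < 1)
    (hlam : 0 < lam) (hκ : 0 < kappa A lam) (hγ0 : 0 < γ) (hγ : γ < 1 / 4)
    (h1 : 1 / (1 - 4 * γ) * sigma A (k + 1) ^ 2 ≤ lam) (h2 : lam ≤ (1 - 4 * γ) * sigma A k ^ 2)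
    {ridge : RidgeProc n d} {D : ℝ≥0∞}
    (h : ∀ z, fail (ridge A lam z (innerEps c₂ A lam ε γ) (innerDelta c₁ ε δ γ))
      (RidgeApprox A lam z (innerEps c₂ A lam ε γ)) ≤ D) :
    fail (pcProj ridge c₁ c₂ A y ε δ lam γ)
      (fun s => ‖s - mulE (topProj A lam) y‖ ≤ ε * ‖y‖) ≤ (2 * iters c₁ ε γ + 1 : ℕ) * D := by
  have hc₂0 : 0 < c₂ := by linarith
  have hε'0 : 0 < innerEps c₂ A lam ε γ := by rw [innerEps]; positivity
  set ε' := innerEps c₂ A lam ε γ with hε'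
  set δ' := innerDelta c₁ ε δ γ
  set q := iters c₁ ε γ with hq
  set e := ε' * √(kappa A lam) with he
  have hee : e = c₂⁻¹ * ε ^ 2 * γ ^ 2 := by
    rw [he, hε', innerEps, div_mul_cancel₀ _ (Real.sqrt_pos.2 hκ).ne']
  have he0 : 0 ≤ e := by positivity
  have hc₂i : 24 * c₂⁻¹ ≤ 1 := by
    rw [← div_eq_mul_inv, div_le_one hc₂0]
    exact hc₂
  have h24e : 24 * e ≤ ε ^ 2 * γ ^ 2 := by
    rw [hee]
    have := mul_le_mul_of_nonneg_right hc₂i (by positivity : 0 ≤ ε ^ 2 * γ ^ 2)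
    linarith
  have he12 : 12 * e ≤ (2 * γ) ^ 2 / 4 := by
    have : ε ^ 2 ≤ 1 := by nlinarith
    nlinarith [sq_nonneg γ]
  set r : Fin d → ℝ := fun i => ev A i / (ev A i + lam) with hr
  have hgap := fun i => abs_two_mul_div_sub_one (ev_nonneg A i) hlam hγ0 hγ
    (sq_sigma_gap hγ h1 h2 i)
  have hrr : ∀ i, 2 * γ ≤ |2 * r i - 1| ∧ |2 * r i - 1| ≤ 1 := fun i => (hgap i).1
  have hα0 : 0 < 2 * γ := by linarith
  have hα1 : 2 * γ ≤ 1 := by linarith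
  have hS := fail_softProj_le (δ' := δ') hlam hε'0.le h
  have hP : mulE (topProj A lam) y = dOp (eigB A) (fun i => if 1 / 2 ≤ r i then 1 else 0) y := by
    refine ext_repr (b := eigB A) fun i => ?_
    rw [repr_mulE_topProj, repr_dOp]
    simp only [hr, (hgap i).2]
  simp only [pcProj, vscale, vsub, fail_exec_bind]
  have hcast : ((2 * q + 1 : ℕ) : ℝ≥0∞) * D = D + ((2 * q : ℕ) * D + 0) := by
    push_cast
    ring
  rw [hcast]
  refine fail_bind_le (hS y) fun s hs => ?_
  -- The zeroth partial sum is `1/2 + (r - 1/2) = r`, so a single call starts both `s` and `w`, with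
  -- the same error.
  have h0 : LoopInv (eigB A) r (2 * γ) (12 * e) y 0 (s, s - (1 / 2 : ℝ) • y) := by
    have hw : s - (1 / 2 : ℝ) • y - exactW (eigB A) r y 0 = s - dOp (eigB A) r y := by
      refine ext_repr (b := eigB A) fun i => ?_
      simp only [exactW, repr_dOp, map_sub, map_smul, PiLp.sub_apply, PiLp.smul_apply, smul_eq_mul,
        cb_zero, pow_zero]
      ring
    have hs' : s - exactS (eigB A) r y 0 = s - dOp (eigB A) r y := by
      refine ext_repr (b := eigB A) fun i => ?_
      simp [exactS, repr_dOp, cb_zero]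
    have h3 : e * ‖y‖ ≤ 2 * (12 * e) * 1 * ‖y‖ :=
      mul_le_mul_of_nonneg_right (by linarith) (norm_nonneg y)
    constructor
    · rw [hw, pow_zero]
      exact hs.trans h3
    · rw [hs']
      simpa using hs.trans h3
  rw [fail_exec_bind, fail_exec_bind]
  refine fail_bind_le
    (fail_pcLoop_le (eigB A) hα0 hα1 hrr he0 he12 hS h0 q) fun st hst => ?_
  rw [fail_pure]
  have h3 := hst.2
  have h4 := norm_exactS_sub_le (eigB A) hα0 hα1 hrr y q
  rw [← hP] at h4
  have h5 := exp_iters_le (by linarith : 1 / 4 ≤ c₁) hε0 hε1 hγ0 hγ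
  have h6 := sum_geom_half_le hα0 hα1 (q + 1)
  -- The geometric sum is at most `2/(2γ)²`, so the left side is at most `12e/γ² ≤ ε²/2`.
  have h7 : 2 * (12 * e) * ∑ j ∈ Finset.range (q + 1), (1 - (2 * γ) ^ 2 / 2) ^ j ≤ ε / 2 := by
    refine (mul_le_mul_of_nonneg_left h6 (by positivity)).trans ?_
    rw [← mul_div_assoc, div_le_iff₀ (by positivity)]
    have : ε ^ 2 ≤ ε := by nlinarith
    nlinarith [sq_nonneg γ, mul_le_mul_of_nonneg_right this (sq_nonneg γ)]
  have h8 := mul_le_mul_of_nonneg_right h7 (norm_nonneg y)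
  have h9 := mul_le_mul_of_nonneg_right h5 (norm_nonneg y)
  calc ‖st.1 - mulE (topProj A lam) y‖
      = ‖(st.1 - exactS (eigB A) r y q) + (exactS (eigB A) r y q - mulE (topProj A lam) y)‖ := by
        rw [sub_add_sub_cancel]
    _ ≤ _ := norm_add_le _ _
    _ ≤ ε * ‖y‖ := by
      rw [← hq] at h9
      linarith

end Accuracy

/-! ### Accelerated gradient descent -/

section AGD

variable {n d : ℕ} (A : Matrix (Fin n) (Fin d) ℝ) {lam : ℝ}

theorem gramSq_sub_smul (a g : Vec d) (t : ℝ) :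
    gramSq A lam (a - t • g) = gramSq A lam a - 2 * t * inner ℝ g (mulE (gram A lam) a) +
      t ^ 2 * gramSq A lam g := by
  have h : mulE A (t • g) = t • mulE A g := by
    rw [mulE_eq_toEuclideanLin, map_smul, ← mulE_eq_toEuclideanLin]
  rw [inner_mulE_gram, gramSq, gramSq, gramSq, mulE_sub, h, norm_sub_sq_real, norm_sub_sq_real,
    norm_smul, norm_smul, inner_smul_right, inner_smul_right, mul_pow, mul_pow, Real.norm_eq_abs,
    sq_abs, real_inner_comm, real_inner_comm g]
  ring

/-- Coordinates are centred at the solution: `a` is the extrapolated point, `c` the previous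
iterate, `v` the auxiliary point. The gradient step gains `‖g‖²/L`, exactly the quadratic term in
the expansion of the new auxiliary norm. What remains follows from convexity of the squared norm,
`λ‖a‖² ≤ ‖a‖_H²` and `‖a - c‖_H² ≥ 0`. -/
theorem agd_potential (hlam : 0 < lam) {q L : ℝ} (hL : L = sigma A 1 ^ 2 + lam) (hq0 : 0 < q)
    (hq1 : q ≤ 1) (hq : q ^ 2 * L = lam) {a c v : Vec d} (hv : q • v = (1 + q) • a - c) :
    gramSq A lam (a - (1 / L) • mulE (gram A lam) a) +
        lam * ‖(1 - q) • v + q • a - (1 / (q * L)) • mulE (gram A lam) a‖ ^ 2 ≤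
      (1 - q) * (gramSq A lam c + lam * ‖v‖ ^ 2) := by
  have hL0 : 0 < L := by rw [hL]; positivity
  set g := mulE (gram A lam) a with hg
  set p := (1 - q) • v + q • a with hp
  have hgg := gramSq_sub_smul A (lam := lam) a g (1 / L)
  rw [← hg, real_inner_self_eq_norm_sq] at hgg
  have hgL : gramSq A lam g ≤ L * ‖g‖ ^ 2 := hL ▸ gramSq_le A g
  have h1 : gramSq A lam (a - (1 / L) • g) ≤ gramSq A lam a - 1 / L * ‖g‖ ^ 2 := by
    rw [hgg]
    have h2 := mul_le_mul_of_nonneg_left hgL (sq_nonneg (1 / L))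
    have h3 : (1 / L) ^ 2 * (L * ‖g‖ ^ 2) = 1 / L * ‖g‖ ^ 2 := by
      field_simp
    linarith
  have h4 : lam * ‖p - (1 / (q * L)) • g‖ ^ 2 =
      lam * ‖p‖ ^ 2 - 2 * inner ℝ g (q • p) + 1 / L * ‖g‖ ^ 2 := by
    rw [norm_sub_sq_real, inner_smul_right, inner_smul_right, norm_smul, mul_pow,
      Real.norm_eq_abs, sq_abs, real_inner_comm p, ← hq]
    field_simp
  have hqp : q • p = a - (1 - q) • c := by
    rw [hp, smul_add, smul_comm, hv]
    module
  have h5 : inner ℝ g (q • p) = gramSq A lam a - (1 - q) * inner ℝ c g := by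
    rw [hqp, inner_sub_right, inner_smul_right, gramSq_eq_inner, ← hg, real_inner_comm g,
      real_inner_comm c]
  have h6 : ‖p‖ ^ 2 ≤ (1 - q) * ‖v‖ ^ 2 + q * ‖a‖ ^ 2 := by
    have h7 : (1 - q) * ‖v‖ ^ 2 + q * ‖a‖ ^ 2 - ‖p‖ ^ 2 = q * (1 - q) * ‖v - a‖ ^ 2 := by
      rw [hp, norm_sub_sq_real, norm_add_sq_real, norm_smul, norm_smul, inner_smul_left,
        inner_smul_right, mul_pow, mul_pow, Real.norm_eq_abs, Real.norm_eq_abs, sq_abs, sq_abs]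
      simp only [conj_trivial]
      ring
    have : 0 ≤ q * (1 - q) * ‖v - a‖ ^ 2 :=
      mul_nonneg (mul_nonneg hq0.le (by linarith)) (sq_nonneg _)
    linarith
  have h8 := gramSq_sub_smul A (lam := lam) a c 1
  rw [← hg, one_smul] at h8
  have h9 := gramSq_nonneg A hlam (a - c)
  have h10 := le_gramSq A (lam := lam) a
  have h11 := mul_le_mul_of_nonneg_left h6 hlam.le
  have h12 := mul_nonneg (sub_nonneg.2 hq1) h9
  rw [h8] at h12
  have h13 := mul_le_mul_of_nonneg_left h10 hq0.le
  rw [h4, h5]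
  linarith

/-- The point `v` of the potential function of accelerated gradient descent. -/
def agdAux (q : ℝ) (st : Vec d × Vec d) : Vec d := st.2 + q⁻¹ • (st.2 - st.1)

theorem fail_agdLoop (hlam : 0 < lam) {q L : ℝ} (hL : L = sigma A 1 ^ 2 + lam) (hq0 : 0 < q)
    (hq1 : q ≤ 1) (hq : q ^ 2 * L = lam) {y x₀ : Vec d} (hx : mulE (gram A lam) x₀ = y) (t : ℕ) :
    fail (agdLoop A lam L ((1 - q) / (1 + q)) y t) (fun st =>
      gramSq A lam (st.1 - x₀) + lam * ‖agdAux q st - x₀‖ ^ 2 ≤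
        (1 - q) ^ t * (gramSq A lam x₀ + lam * ‖x₀‖ ^ 2)) = 0 := by
  have hL0 : 0 < L := by rw [hL]; positivity
  induction t with
  | zero =>
    rw [agdLoop]
    refine fail_exec ?_
    have h : gramSq A lam (-x₀) = gramSq A lam x₀ := by
      simp [gramSq, mulE_eq_toEuclideanLin]
    simp [agdAux, h]
  | succ t ih =>
    rw [agdLoop, ← nonpos_iff_eq_zero, ← add_zero (0 : ℝ≥0∞)]
    refine fail_bind_le ih.le fun st hst => ?_
    simp only [ridgeGrad, gramVec, matVec, vadd, vsub, vscale]
    rw [fail_bind_eq]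
    simp only [ex_bind, ex_exec, fail_exec_bind]
    refine (fail_pure ?_).le
    obtain ⟨x, z⟩ := st
    simp only at hst ⊢
    have hv : q • (agdAux q (x, z) - x₀) = (1 + q) • (z - x₀) - (x - x₀) := by
      simp only [agdAux]
      rw [smul_sub, smul_add, smul_smul, mul_inv_cancel₀ hq0.ne']
      module
    have h := agd_potential A hlam hL hq0 hq1 hq hv
    have hg : mulE Aᵀ (mulE A z) + lam • z - y = mulE (gram A lam) (z - x₀) := by
      rw [mulE_sub, hx, mulE_gram]
    rw [hg]
    set g := mulE (gram A lam) (z - x₀)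
    have hx1 : z - (1 / L) • g - x₀ = z - x₀ - (1 / L) • g := by abel
    -- The momentum `(1-q)/(1+q)` is the value for which the auxiliary point moves as
    -- `agd_potential` requires.
    have hx2 : agdAux q (z - (1 / L) • g,
        z - (1 / L) • g + ((1 - q) / (1 + q)) • (z - (1 / L) • g - x)) - x₀ =
        (1 - q) • (agdAux q (x, z) - x₀) + q • (z - x₀) - (1 / (q * L)) • g := by
      simp only [agdAux]
      have hq2 : 1 + q ≠ 0 := by positivity
      match_scalars <;> field_simp <;> ring
    rw [hx1, hx2, pow_succ]
    refine h.trans ?_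
    calc _ ≤ (1 - q) * ((1 - q) ^ t * (gramSq A lam x₀ + lam * ‖x₀‖ ^ 2)) :=
          mul_le_mul_of_nonneg_left hst (by linarith)
      _ = _ := by ring

theorem fail_agdRidge (hlam : 0 < lam) {ε : ℝ} (hε : 0 < ε) (δ : ℝ) (y : Vec d) :
    fail (agdRidge n d A lam y ε δ) (RidgeApprox A lam y ε) = 0 := by
  set L := sigma A 1 ^ 2 + lam with hL
  have hL0 : 0 < L := by positivity
  have hLlam : lam ≤ L := by
    rw [hL]
    linarith [sq_nonneg (sigma A 1)]
  set q := √lam / √L with hqdef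
  have hsL : 0 < √L := Real.sqrt_pos.2 hL0
  have hsl : 0 < √lam := Real.sqrt_pos.2 hlam
  have hq0 : 0 < q := div_pos hsl hsL
  have hq1 : q ≤ 1 := (div_le_one hsL).2 (Real.sqrt_le_sqrt hLlam)
  have hq : q ^ 2 * L = lam := by
    rw [hqdef, div_pow, Real.sq_sqrt hlam.le, Real.sq_sqrt hL0.le, div_mul_cancel₀ _ hL0.ne']
  have hβ : (√L - √lam) / (√L + √lam) = (1 - q) / (1 + q) := by
    rw [hqdef]
    field_simp
  set x₀ := mulE (gram A lam)⁻¹ y with hx₀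
  have hx : mulE (gram A lam) x₀ = y := mulE_gram_mulE_inv A hlam y
  simp only [agdRidge, fail_exec_bind]
  rw [← hL, hβ]
  set N := ⌈2 * √(L / lam) * Real.log (2 / ε)⌉₊ with hN
  rw [← nonpos_iff_eq_zero, ← add_zero (0 : ℝ≥0∞)]
  refine fail_bind_le (fail_agdLoop A hlam hL hq0 hq1 hq hx N).le fun st hst => ?_
  refine (fail_pure ?_).le
  rw [ridgeApprox_iff A hlam _ _ hε.le, ← hx₀]
  have h1 : gramSq A lam (st.1 - x₀) ≤ (1 - q) ^ N * (2 * gramSq A lam x₀) := by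
    have h2 := le_gramSq A (lam := lam) x₀
    have h3 : 0 ≤ lam * ‖agdAux q st - x₀‖ ^ 2 := by positivity
    have h4 : (1 - q) ^ N * (gramSq A lam x₀ + lam * ‖x₀‖ ^ 2) ≤
        (1 - q) ^ N * (2 * gramSq A lam x₀) :=
      mul_le_mul_of_nonneg_left (by linarith) (pow_nonneg (by linarith) _)
    linarith
  -- The starting potential is at most `2‖x₀‖_H²`, so a factor `ε²/2` would already suffice.
  have h5 : (1 - q) ^ N ≤ ε ^ 2 / 4 := by
    calc (1 - q) ^ N ≤ (Real.exp (-q)) ^ N :=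
          pow_le_pow_left₀ (by linarith) (by linarith [Real.add_one_le_exp (-q)]) _
      _ = Real.exp (-(N * q)) := by
          rw [← Real.exp_nat_mul]
          congr 1
          ring
      _ ≤ Real.exp (2 * Real.log (ε / 2)) := by
          refine Real.exp_le_exp.2 ?_
          have h6 : 2 * √(L / lam) * Real.log (2 / ε) ≤ N := Nat.le_ceil _
          have h7 := mul_le_mul_of_nonneg_right h6 hq0.le
          have h8 : √(L / lam) * q = 1 := by
            rw [hqdef, Real.sqrt_div hL0.le]
            field_simp
          have h9 : 2 * √(L / lam) * Real.log (2 / ε) * q = 2 * Real.log (2 / ε) := by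
            calc _ = 2 * Real.log (2 / ε) * (√(L / lam) * q) := by ring
              _ = _ := by rw [h8, mul_one]
          have h10 : Real.log (2 / ε) = -Real.log (ε / 2) := by
            rw [← Real.log_inv, inv_div]
          rw [h9, h10] at h7
          linarith
      _ = ε ^ 2 / 4 := by
          rw [two_mul, Real.exp_add, Real.exp_log (by positivity)]
          ring
  have h11 := gramSq_nonneg A hlam x₀
  have h12 := mul_le_mul_of_nonneg_right h5 h11
  nlinarith [mul_nonneg (sq_nonneg ε) h11]

end AGD

/-! ### Variance-reduced stochastic gradient descent -/

/-- Markov's inequality divided by `t`. The case `t = 0`, which occurs when the exact solution is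
`0`, is separate: zero expectation forces zero value on every possible outcome. -/
theorem Comp.fail_le_of_ex_le {α : Type} (p : Comp α) (g : α → ℝ≥0∞) {t δ : ℝ≥0∞} (ht : t ≠ ⊤)
    (h : ex p g ≤ t * δ) : fail p (fun v => g v ≤ t) ≤ δ := by
  by_cases h0 : t = 0
  · rw [h0, zero_mul, nonpos_iff_eq_zero, ex, ENNReal.tsum_eq_zero] at h
    refine (le_of_eq ?_).trans (zero_le (a := δ))
    rw [← surely_iff_fail]
    intro o ho
    rw [h0, nonpos_iff_eq_zero]
    exact (mul_eq_zero.1 (h o)).resolve_left ho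
  · exact (ENNReal.mul_le_mul_iff_right h0 ht).1 ((mul_fail_le_ex p g t).trans h)

section SVRG

variable {n d : ℕ} (A : Matrix (Fin n) (Fin d) ℝ) {lam : ℝ}

theorem rowSq_nonneg (i : Fin n) : 0 ≤ rowSq A i := Finset.sum_nonneg fun _ _ => sq_nonneg _

theorem norm_row_sq (i : Fin n) : ‖row A i‖ ^ 2 = rowSq A i := by
  rw [EuclideanSpace.norm_sq_eq]
  simp [row, rowSq]

theorem mulE_apply (x : Vec d) (i : Fin n) : mulE A x i = inner ℝ (row A i) x := by
  rw [inner_eq_dotProduct]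
  rfl

theorem frobSq_eq : frobSq A = ∑ i, rowSq A i := rfl

theorem frobSq_pos {A : Matrix (Fin n) (Fin d) ℝ} (hA : A ≠ 0) : 0 < frobSq A := by
  by_contra h
  apply hA
  have h0 : frobSq A = 0 := le_antisymm (not_lt.1 h) (Finset.sum_nonneg fun i _ => rowSq_nonneg A i)
  rw [frobSq_eq, Finset.sum_eq_zero_iff_of_nonneg fun i _ => rowSq_nonneg A i] at h0
  ext i j
  have h1 := h0 i (Finset.mem_univ i)
  rw [rowSq, Finset.sum_eq_zero_iff_of_nonneg fun i _ => sq_nonneg _] at h1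
  exact pow_eq_zero_iff two_ne_zero |>.1 (h1 j (Finset.mem_univ j))

theorem norm_mulE_sq_le_frobSq (x : Vec d) : ‖mulE A x‖ ^ 2 ≤ frobSq A * ‖x‖ ^ 2 := by
  rw [EuclideanSpace.norm_sq_eq, frobSq_eq, Finset.sum_mul]
  refine Finset.sum_le_sum fun i _ => ?_
  rw [mulE_apply, ← norm_row_sq, Real.norm_eq_abs, ← mul_pow]
  exact pow_le_pow_left₀ (abs_nonneg _) (abs_real_inner_le_norm _ _) 2

theorem ev_le_frobSq (i : Fin d) : ev A i ≤ frobSq A := by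
  have h := norm_mulE_sq_le_frobSq A (eigB A i)
  have h1 : ‖mulE A (eigB A i)‖ ^ 2 = ev A i := by
    have h2 : inner ℝ (eigB A i) (mulE Aᵀ (mulE A (eigB A i))) = ev A i := by
      rw [← mulE_mul, mulE_gram_eigB, inner_smul_right, real_inner_self_eq_norm_sq]
      simp
    rw [← h2, inner_mulE, Matrix.transpose_transpose, real_inner_self_eq_norm_sq]
  rw [h1] at h
  simpa using h

theorem norm_mulE_gram_sq_le (hlam : 0 < lam) (x : Vec d) :
    ‖mulE (gram A lam) x‖ ^ 2 ≤ (frobSq A + lam) * gramSq A lam x := by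
  rw [gramSq_eq_inner, inner_repr (eigB A), norm_sq_repr (eigB A), Finset.mul_sum]
  refine Finset.sum_le_sum fun i _ => ?_
  rw [repr_mulE_gram]
  have h1 := ev_nonneg A i
  have h2 := mul_le_mul_of_nonneg_right (add_le_add_left (ev_le_frobSq A i) lam)
    (mul_nonneg (add_nonneg h1 hlam.le) (sq_nonneg ((eigB A).repr x i)))
  calc _ = _ := by ring
    _ ≤ _ := h2
    _ = _ := by ring

theorem gramSq_smul (t : ℝ) (x : Vec d) : gramSq A lam (t • x) = t ^ 2 * gramSq A lam x := by
  rw [gramSq, gramSq, mulE_eq_toEuclideanLin, map_smul, ← mulE_eq_toEuclideanLin, norm_smul,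
    norm_smul, mul_pow, mul_pow, Real.norm_eq_abs, sq_abs]
  ring

theorem tsum_rowDist (hA : A ≠ 0) {f : Fin n → ℝ} (hf : ∀ i, 0 ≤ f i) :
    ∑' i, rowDist A hA i * ENNReal.ofReal (f i) =
      ENNReal.ofReal (∑ i, rowSq A i / frobSq A * f i) := by
  have hF := frobSq_pos hA
  have hsum : ∑' i, ENNReal.ofReal (rowSq A i) = ENNReal.ofReal (frobSq A) := by
    rw [tsum_fintype, ← ENNReal.ofReal_sum_of_nonneg fun i _ => rowSq_nonneg A i]
    rfl
  rw [tsum_fintype, ENNReal.ofReal_sum_of_nonneg fun i _ =>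
    mul_nonneg (div_nonneg (rowSq_nonneg A i) hF.le) (hf i)]
  refine Finset.sum_congr rfl fun i _ => ?_
  rw [rowDist, PMF.normalize_apply, hsum,
    ENNReal.ofReal_mul (div_nonneg (rowSq_nonneg A i) hF.le), ENNReal.ofReal_div_of_pos hF,
    div_eq_mul_inv]

/-- One stochastic step from `x` with row `i`. -/
def svrgNext (lam F η : ℝ) (c G x : Vec d) (i : Fin n) : Vec d :=
  x - η • ((F / rowSq A i * inner ℝ (row A i) (x - c)) • row A i + lam • (x - c) + G)

theorem ex_svrgInner_succ (hA : A ≠ 0) (F η : ℝ) (c G : Vec d) (t : ℕ)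
    (g : Vec d × Vec d → ℝ≥0∞) :
    ex (svrgInner A hA lam F η c G (t + 1)) g = ex (svrgInner A hA lam F η c G t) fun st =>
      ∑' i, rowDist A hA i * g (svrgNext A lam F η c G st.1 i, st.2 + st.1) := by
  rw [svrgInner]
  simp only [ex_bind, vadd, vsub, dot, vscale, ex_exec, ex_draw, ex_pure]
  rfl

/-- The sampled vector has mean `Aᵀ A u` and second moment `‖A‖_F² ‖A u‖²`. -/
theorem sum_rowSq_norm_sub (hA : A ≠ 0) (η : ℝ) (u h : Vec d) :
    ∑ i, rowSq A i / frobSq A *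
        ‖h - (η * (frobSq A / rowSq A i * inner ℝ (row A i) u)) • row A i‖ ^ 2 =
      ‖h‖ ^ 2 - 2 * η * inner ℝ (mulE A u) (mulE A h) + η ^ 2 * frobSq A * ‖mulE A u‖ ^ 2 := by
  have hF := frobSq_pos hA
  have h1 : ∀ i, rowSq A i / frobSq A *
        ‖h - (η * (frobSq A / rowSq A i * inner ℝ (row A i) u)) • row A i‖ ^ 2 =
      rowSq A i * (‖h‖ ^ 2 / frobSq A) - 2 * η * (mulE A u i * mulE A h i) +
        η ^ 2 * frobSq A * ‖mulE A u i‖ ^ 2 := by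
    intro i
    rw [Real.norm_eq_abs, sq_abs, mulE_apply, mulE_apply]
    -- A zero row makes the quotient `F / 0`, but it has probability zero and the row itself
    -- vanishes.
    by_cases hi : rowSq A i = 0
    · have hr : row A i = 0 := by
        rw [← norm_eq_zero, ← pow_eq_zero_iff two_ne_zero, norm_row_sq, hi]
      simp [hi, hr]
    · rw [norm_sub_sq_real, inner_smul_right, norm_smul, mul_pow, norm_row_sq, Real.norm_eq_abs,
        sq_abs, real_inner_comm (row A i) h]
      field_simp
  simp_rw [h1]
  rw [Finset.sum_add_distrib, Finset.sum_sub_distrib, ← Finset.sum_mul, ← Finset.mul_sum,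
    ← Finset.mul_sum, ← frobSq_eq, ← EuclideanSpace.norm_sq_eq, inner_eq_dotProduct, dotProduct]
  field_simp

/-- The expected step is the gradient step `e - ηHe`, and the variance is controlled by the
distances of `x` and `c` from the solution. With `η(F+λ) = 1/8`, the gain `2η` loses `η/8` to the
squared gradient and `η/4` to the variance, leaving `13η/8`. -/
theorem svrg_step_le (hA : A ≠ 0) (hlam : 0 < lam) {c x x₀ : Vec d} :
    ∑ i, rowSq A i / frobSq A * ‖svrgNext A lam (frobSq A) (1 / (8 * (frobSq A + lam))) c
        (mulE (gram A lam) (c - x₀)) x i - x₀‖ ^ 2 ≤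
      ‖x - x₀‖ ^ 2 - 13 / 8 * (1 / (8 * (frobSq A + lam))) * gramSq A lam (x - x₀) +
        1 / 4 * (1 / (8 * (frobSq A + lam))) * gramSq A lam (c - x₀) := by
  have hF := frobSq_pos hA
  set F := frobSq A with hFdef
  set η := 1 / (8 * (F + lam)) with hη
  have hη0 : 0 < η := by positivity
  have hηL : η * (F + lam) = 1 / 8 := by
    rw [hη]
    field_simp
  set e := x - x₀ with he
  set ec := c - x₀ with hec
  set u := x - c with hu
  have hue : u = e - ec := by rw [hu, he, hec]; abel
  set h := e - η • mulE (gram A lam) e + η • mulE Aᵀ (mulE A u) with hh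
  have h1 : ∀ i, svrgNext A lam F η c (mulE (gram A lam) ec) x i - x₀ =
      h - (η * (F / rowSq A i * inner ℝ (row A i) u)) • row A i := by
    intro i
    have h2 : mulE (gram A lam) ec = mulE (gram A lam) e - mulE Aᵀ (mulE A u) - lam • u := by
      rw [sub_sub, ← mulE_gram, ← mulE_sub, hue, sub_sub_cancel]
    rw [svrgNext, h2, hh, ← hu, he]
    module
  simp_rw [h1]
  rw [sum_rowSq_norm_sub A hA, ← hFdef]
  -- `h` contains the mean `η M` of the random term; completing the square recovers the gradient
  -- step, and the leftover `-η²‖M‖²` is dropped at the end.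
  have h3 : inner ℝ (mulE A u) (mulE A h) = inner ℝ h (mulE Aᵀ (mulE A u)) := by
    rw [inner_mulE, real_inner_comm]
  set M := mulE Aᵀ (mulE A u)
  have h4 : ‖h‖ ^ 2 - 2 * η * inner ℝ h M =
      ‖e - η • mulE (gram A lam) e‖ ^ 2 - η ^ 2 * ‖M‖ ^ 2 := by
    rw [hh, norm_add_sq_real, inner_add_left, inner_smul_right, inner_smul_left, norm_smul,
      mul_pow, Real.norm_eq_abs, sq_abs, real_inner_self_eq_norm_sq]
    simp only [conj_trivial]
    ring
  have h5 : ‖e - η • mulE (gram A lam) e‖ ^ 2 =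
      ‖e‖ ^ 2 - 2 * η * gramSq A lam e + η ^ 2 * ‖mulE (gram A lam) e‖ ^ 2 := by
    rw [norm_sub_sq_real, inner_smul_right, ← gramSq_eq_inner, norm_smul, mul_pow,
      Real.norm_eq_abs, sq_abs]
    ring
  have h6 : η ^ 2 * ‖mulE (gram A lam) e‖ ^ 2 ≤ 1 / 8 * η * gramSq A lam e := by
    have := mul_le_mul_of_nonneg_left (norm_mulE_gram_sq_le A hlam e) (sq_nonneg η)
    calc _ ≤ _ := this
      _ = η * (F + lam) * η * gramSq A lam e := by ring
      _ = _ := by rw [hηL]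
  have h7 : ‖mulE A u‖ ^ 2 ≤ 2 * (gramSq A lam e + gramSq A lam ec) := by
    rw [hue, mulE_sub, gramSq, gramSq]
    have h8 := norm_sub_le (mulE A e) (mulE A ec)
    have h9 := pow_le_pow_left₀ (norm_nonneg _) h8 2
    have h10 : 0 ≤ lam * ‖e‖ ^ 2 := by positivity
    have h11 : 0 ≤ lam * ‖ec‖ ^ 2 := by positivity
    nlinarith [sq_nonneg (‖mulE A e‖ - ‖mulE A ec‖)]
  have h8 : η ^ 2 * F * ‖mulE A u‖ ^ 2 ≤ 1 / 4 * η * (gramSq A lam e + gramSq A lam ec) := by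
    have h9 : η ^ 2 * F ≤ η * (1 / 8) := by
      rw [← hηL]
      nlinarith
    have h10 := mul_le_mul h9 h7 (sq_nonneg _) (by positivity)
    linarith
  have h9 : 0 ≤ η ^ 2 * ‖M‖ ^ 2 := by positivity
  rw [h3]
  linarith

/-- Joint convexity of `‖x‖²/t`, from `‖a - t b‖_H² ≥ 0`. Division by zero yields `0`, so `t = 0`
needs `a = 0`. -/
theorem gramSq_add_div_le (hlam : 0 < lam) {t : ℕ} {a b : Vec d} (h0 : t = 0 → a = 0) :
    gramSq A lam (a + b) / (t + 1 : ℕ) ≤ gramSq A lam a / t + gramSq A lam b := by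
  rcases Nat.eq_zero_or_pos t with ht | ht
  · rw [h0 ht, ht]
    simp
  · have ht' : (0 : ℝ) < t := Nat.cast_pos.2 ht
    have h1 := gramSq_sub_smul A (lam := lam) a b (-1)
    have h2 := gramSq_sub_smul A (lam := lam) a b t
    have h3 := gramSq_nonneg A hlam (a - (t : ℝ) • b)
    rw [neg_one_smul, sub_neg_eq_add] at h1
    rw [h2] at h3
    rw [h1]
    push_cast
    rw [div_add' _ _ _ ht'.ne', div_le_div_iff₀ (by positivity) ht']
    nlinarith

/-- The potential function after `t` stochastic steps. -/
def svrgPot (lam η : ℝ) (x₀ : Vec d) (t : ℕ) (st : Vec d × Vec d) : ℝ :=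
  ‖st.1 - x₀‖ ^ 2 + 13 / 8 * η * (gramSq A lam (st.2 - (t : ℝ) • x₀) / t)

theorem svrgPot_nonneg (hlam : 0 < lam) {η : ℝ} (hη : 0 ≤ η) (x₀ : Vec d) (t : ℕ)
    (st : Vec d × Vec d) : 0 ≤ svrgPot A lam η x₀ t st := by
  have := gramSq_nonneg A hlam (st.2 - (t : ℝ) • x₀)
  rw [svrgPot]
  positivity

/-- Only the sum of the visited points is stored. Its normalised squared deviation in `svrgPot`
stands in for the sum of the individual ones, so Jensen's inequality is built into the potential. -/
theorem tsum_svrgPot_le (hA : A ≠ 0) (hlam : 0 < lam) (c x₀ : Vec d) {t : ℕ}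
    {st : Vec d × Vec d} (h0 : t = 0 → st.2 = 0) :
    ∑' i, rowDist A hA i * ENNReal.ofReal (svrgPot A lam (1 / (8 * (frobSq A + lam))) x₀ (t + 1)
        (svrgNext A lam (frobSq A) (1 / (8 * (frobSq A + lam))) c (mulE (gram A lam) (c - x₀)) st.1 i,
          st.2 + st.1)) ≤
      ENNReal.ofReal (svrgPot A lam (1 / (8 * (frobSq A + lam))) x₀ t st) +
        ENNReal.ofReal (1 / 4 * (1 / (8 * (frobSq A + lam))) * gramSq A lam (c - x₀)) := by
  have hF := frobSq_pos hA
  have hη0 : 0 < 1 / (8 * (frobSq A + lam)) := by positivity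
  have hstep := svrg_step_le A hA hlam (c := c) (x := st.1) (x₀ := x₀)
  set η := 1 / (8 * (frobSq A + lam))
  have hN := gramSq_nonneg A hlam (c - x₀)
  rw [tsum_rowDist A hA fun i => svrgPot_nonneg A hlam hη0.le _ _ _,
    ← ENNReal.ofReal_add (svrgPot_nonneg A hlam hη0.le _ _ _) (by positivity)]
  refine ENNReal.ofReal_le_ofReal ?_
  simp only [svrgPot, mul_add]
  rw [Finset.sum_add_distrib, ← Finset.sum_mul, ← Finset.sum_div, ← frobSq_eq, div_self hF.ne',
    one_mul]
  have h1 : st.2 + st.1 - ((t + 1 : ℕ) : ℝ) • x₀ = (st.2 - (t : ℝ) • x₀) + (st.1 - x₀) := by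
    push_cast
    module
  have h2 := gramSq_add_div_le A hlam (t := t) (a := st.2 - (t : ℝ) • x₀) (b := st.1 - x₀)
    (fun ht => by simp [h0 ht, ht])
  have h3 := mul_le_mul_of_nonneg_left h2 (by positivity : 0 ≤ 13 / 8 * η)
  rw [h1]
  linarith

theorem ex_svrgInner_le (hA : A ≠ 0) (hlam : 0 < lam) (c x₀ : Vec d) (t : ℕ) :
    ex (svrgInner A hA lam (frobSq A) (1 / (8 * (frobSq A + lam))) c
        (mulE (gram A lam) (c - x₀)) (t + 1))
        (fun st => ENNReal.ofReal (svrgPot A lam (1 / (8 * (frobSq A + lam))) x₀ (t + 1) st)) ≤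
      ENNReal.ofReal (‖c - x₀‖ ^ 2) + (t + 1 : ℕ) *
        ENNReal.ofReal (1 / 4 * (1 / (8 * (frobSq A + lam))) * gramSq A lam (c - x₀)) := by
  induction t with
  | zero =>
    rw [ex_svrgInner_succ, svrgInner, ex_exec]
    refine (tsum_svrgPot_le A hA hlam c x₀ fun _ => rfl).trans ?_
    simp [svrgPot]
  | succ t ih =>
    rw [ex_svrgInner_succ]
    -- From the first step on, the condition on `t = 0` is vacuous; thus the induction starts at `t
    -- + 1` and needs no information about the stored sum.
    refine (ex_mono _ fun st =>
      tsum_svrgPot_le A hA hlam c x₀ fun h => absurd h t.succ_ne_zero).trans ?_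
    rw [ex_add, ex_const]
    refine (add_le_add ih le_rfl).trans (le_of_eq ?_)
    push_cast
    ring

/-- The choice of `m` gives `ηmλ ≥ 2`, so `‖c - x₀‖²` is at most half of `ηm‖c - x₀‖_H²`. Adding the
quarter from the variance and multiplying by `8/(13ηm)` gives the factor `6/13 < 1/2`. -/
theorem ex_epoch_le (hA : A ≠ 0) (hlam : 0 < lam) (c x₀ : Vec d) {m : ℕ}
    (hm : 16 * (frobSq A + lam) / lam ≤ m) :
    ex (svrgInner A hA lam (frobSq A) (1 / (8 * (frobSq A + lam))) c
        (mulE (gram A lam) (c - x₀)) m)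
        (fun st => ENNReal.ofReal (gramSq A lam ((1 / (m : ℝ)) • st.2 - x₀))) ≤
      ENNReal.ofReal (1 / 2) * ENNReal.ofReal (gramSq A lam (c - x₀)) := by
  have hF := frobSq_pos hA
  have hm0 : (0 : ℝ) < m := lt_of_lt_of_le (by positivity) hm
  obtain ⟨t, rfl⟩ : ∃ t, m = t + 1 := ⟨m - 1, by have := Nat.cast_pos.1 hm0; omega⟩
  have hη0 : 0 < 1 / (8 * (frobSq A + lam)) := by positivity
  have hηm : 2 ≤ 1 / (8 * (frobSq A + lam)) * (t + 1 : ℕ) * lam := by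
    rw [div_le_iff₀ hlam] at hm
    rw [one_div, inv_mul_eq_div, div_mul_eq_mul_div, le_div_iff₀ (by positivity)]
    linarith
  have h := ex_svrgInner_le A hA hlam c x₀ t
  set η := 1 / (8 * (frobSq A + lam))
  set m := t + 1
  have hN := gramSq_nonneg A hlam (c - x₀)
  set s : ℝ := 8 / (13 * η * m) with hs
  have hs0 : 0 < s := by positivity
  have h1 : ∀ st : Vec d × Vec d, ENNReal.ofReal (gramSq A lam ((1 / (m : ℝ)) • st.2 - x₀)) ≤
      ENNReal.ofReal s * ENNReal.ofReal (svrgPot A lam η x₀ m st) := by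
    intro st
    rw [← ENNReal.ofReal_mul hs0.le]
    refine ENNReal.ofReal_le_ofReal ?_
    have h2 : st.2 - (m : ℝ) • x₀ = (m : ℝ) • ((1 / (m : ℝ)) • st.2 - x₀) := by
      rw [smul_sub, smul_smul, mul_one_div_cancel hm0.ne', one_smul]
    rw [svrgPot, h2, gramSq_smul, mul_add]
    have h3 : s * (13 / 8 * η * (((m : ℝ) ^ 2 * gramSq A lam ((1 / (m : ℝ)) • st.2 - x₀)) / m)) =
        gramSq A lam ((1 / (m : ℝ)) • st.2 - x₀) := by
      rw [hs]
      field_simp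
    rw [h3]
    have : 0 ≤ s * ‖st.1 - x₀‖ ^ 2 := by positivity
    linarith
  refine (ex_mono _ h1).trans ?_
  rw [ex_const_mul]
  refine (mul_le_mul_right h _).trans ?_
  rw [← ENNReal.ofReal_natCast, ← ENNReal.ofReal_mul (by positivity),
    ← ENNReal.ofReal_add (by positivity) (by positivity), ← ENNReal.ofReal_mul hs0.le,
    ← ENNReal.ofReal_mul (by norm_num)]
  refine ENNReal.ofReal_le_ofReal ?_
  rw [hs, div_mul_eq_mul_div, div_le_iff₀ (by positivity)]
  have h4 := le_gramSq A (lam := lam) (c - x₀)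
  set N := gramSq A lam (c - x₀)
  have h5 : 2 * ‖c - x₀‖ ^ 2 ≤ η * m * N := by
    calc 2 * ‖c - x₀‖ ^ 2 ≤ η * m * lam * ‖c - x₀‖ ^ 2 :=
          mul_le_mul_of_nonneg_right hηm (sq_nonneg _)
      _ = η * m * (lam * ‖c - x₀‖ ^ 2) := by ring
      _ ≤ _ := mul_le_mul_of_nonneg_left h4 (by positivity)
  have h6 : 0 ≤ η * m * N := by positivity
  linarith

theorem ex_svrgEpochs_le (hA : A ≠ 0) (hlam : 0 < lam) {y x₀ : Vec d}
    (hx : mulE (gram A lam) x₀ = y) {m : ℕ} (hm : 16 * (frobSq A + lam) / lam ≤ m) (k : ℕ) :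
    ex (svrgEpochs A hA lam (frobSq A) (1 / (8 * (frobSq A + lam))) m y k)
        (fun c => ENNReal.ofReal (gramSq A lam (c - x₀))) ≤
      ENNReal.ofReal ((1 / 2) ^ k * gramSq A lam x₀) := by
  induction k with
  | zero =>
    rw [svrgEpochs, ex_exec]
    refine ENNReal.ofReal_le_ofReal (le_of_eq ?_)
    simp [gramSq, mulE_eq_toEuclideanLin]
  | succ k ih =>
    rw [svrgEpochs, ex_bind]
    have h : ∀ c : Vec d, ex (do
        let G ← ridgeGrad A lam y c
        let st ← svrgInner A hA lam (frobSq A) (1 / (8 * (frobSq A + lam))) c G m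
        vscale (1 / (m : ℝ)) st.2) (fun c => ENNReal.ofReal (gramSq A lam (c - x₀))) ≤
        ENNReal.ofReal (1 / 2) * ENNReal.ofReal (gramSq A lam (c - x₀)) := by
      intro c
      have hg : mulE Aᵀ (mulE A c) + lam • c - y = mulE (gram A lam) (c - x₀) := by
        rw [mulE_sub, hx, mulE_gram]
      simp only [ridgeGrad, gramVec, matVec, vscale, vadd, vsub, ex_bind, ex_exec]
      rw [hg]
      exact ex_epoch_le A hA hlam c x₀ hm
    refine (ex_mono _ h).trans ?_
    rw [ex_const_mul, pow_succ', mul_assoc, ENNReal.ofReal_mul (by norm_num)]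
    exact mul_le_mul_right ih _

theorem half_pow_ceil_logb_le {x : ℝ} (hx : 0 < x) : (1 / 2 : ℝ) ^ ⌈Real.logb 2 (1 / x)⌉₊ ≤ x := by
  have h : 1 / x ≤ (2 : ℝ) ^ ⌈Real.logb 2 (1 / x)⌉₊ := by
    rw [← Real.rpow_natCast]
    calc 1 / x = (2 : ℝ) ^ Real.logb 2 (1 / x) :=
          (Real.rpow_logb two_pos (by norm_num) (by positivity)).symm
      _ ≤ _ := Real.rpow_le_rpow_of_exponent_le one_le_two (Nat.le_ceil _)
  rw [one_div_pow]
  exact (one_div_le hx (by positivity)).1 h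

/-- The epochs bring the expected squared error down to `ε²δ‖x₀‖_H²`; Markov's inequality at level
`ε²‖x₀‖_H²` fails with probability at most `δ`. -/
theorem isRidgeSolver_svrgRidge (hA : A ≠ 0) (hlam : 0 < lam) :
    IsRidgeSolver (svrgRidge n d) A lam := by
  intro y ε δ hε hδ
  rw [le_prob_iff]
  set x₀ := mulE (gram A lam)⁻¹ y with hx₀
  have hx : mulE (gram A lam) x₀ = y := mulE_gram_mulE_inv A hlam y
  have hN := gramSq_nonneg A hlam x₀
  simp only [svrgRidge, dif_neg hA, fail_exec_bind]
  have h := ex_svrgEpochs_le A hA hlam hx (Nat.le_ceil _) ⌈Real.logb 2 (1 / (ε ^ 2 * δ))⌉₊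
  have h1 := half_pow_ceil_logb_le (x := ε ^ 2 * δ) (by positivity)
  refine le_trans (fail_mono _ fun v hv => ?_) (fail_le_of_ex_le _ _
    (t := ENNReal.ofReal (ε ^ 2 * gramSq A lam x₀)) ENNReal.ofReal_ne_top (h.trans ?_))
  · rw [ridgeApprox_iff A hlam _ _ hε.le, ← hx₀]
    exact (ENNReal.ofReal_le_ofReal_iff (by positivity)).1 hv
  · rw [← ENNReal.ofReal_mul (by positivity)]
    refine ENNReal.ofReal_le_ofReal ((mul_le_mul_of_nonneg_right h1 hN).trans (le_of_eq ?_))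
    ring

end SVRG

/-! ### Running times and numbers of calls -/

section Time

variable {n d : ℕ} (A : Matrix (Fin n) (Fin d) ℝ) {lam : ℝ}

theorem nnz_transpose : nnz Aᵀ = nnz A := by
  have h : {p : Fin d × Fin n | Aᵀ p.1 p.2 ≠ 0} = Prod.swap '' {p : Fin n × Fin d | A p.1 p.2 ≠ 0} := by
    ext ⟨i, j⟩
    simp
  rw [nnz, h, Set.ncard_image_of_injective _ Prod.swap_injective, nnz]

theorem timeLE_gramVec (x : Vec d) : (gramVec A x).TimeLE (4 * nnz A) := by
  refine (timeLE_bind (timeLE_exec _ _) fun _ => timeLE_exec _ _).mono (le_of_eq ?_)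
  rw [nnz_transpose]
  push_cast
  ring

theorem timeLE_softProj {ridge : RidgeProc n d} {ε δ T : ℝ}
    (h : ∀ x, (ridge A lam x ε δ).TimeLE T) (x : Vec d) :
    (softProj ridge A lam ε δ x).TimeLE (4 * nnz A + T) :=
  timeLE_bind (timeLE_gramVec A x) fun _ => timeLE_call (h _)

theorem timeLE_pcLoop {R : Vec d → Comp (Vec d)} {a : ℝ} (h : ∀ x, (R x).TimeLE a) (s w : Vec d)
    (k : ℕ) : (pcLoop R s w k).TimeLE (k * (2 * a + 3 * d + 6)) := by
  induction k with
  | zero => exact (timeLE_pure _).mono (by simp)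
  | succ k ih =>
    refine (timeLE_bind ih fun _ => timeLE_bind (h _) fun _ => timeLE_bind (timeLE_exec _ _) fun _ =>
      timeLE_bind (h _) fun _ => timeLE_bind (timeLE_exec _ _) fun _ =>
      timeLE_bind (timeLE_exec _ _) fun _ => timeLE_bind (timeLE_exec _ _) fun _ =>
      timeLE_pure _).mono (le_of_eq ?_)
    push_cast
    ring

theorem timeLE_pcProj {ridge : RidgeProc n d} {c₁ c₂ ε δ γ T : ℝ} (hd : d ≤ nnz A)
    (hA : 1 ≤ nnz A) (y : Vec d)
    (h : ∀ x, (ridge A lam x (innerEps c₂ A lam ε γ) (innerDelta c₁ ε δ γ)).TimeLE T) :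
    (pcProj ridge c₁ c₂ A y ε δ lam γ).TimeLE
      ((2 * (iters c₁ ε γ : ℝ) + 1) * (T + 23 * nnz A)) := by
  have hS := timeLE_softProj A h
  have h1 : (pcProj ridge c₁ c₂ A y ε δ lam γ).TimeLE
      ((6 : ℕ) + ((8 : ℕ) + ((3 : ℕ) + ((4 * nnz A + T) + (d + (d +
        ((iters c₁ ε γ : ℝ) * (2 * (4 * nnz A + T) + 3 * d + 6) + 0))))))) := by
    exact timeLE_exec_bind <| timeLE_exec_bind <| timeLE_exec_bind <|
      timeLE_bind (hS y) fun _ => timeLE_bind (timeLE_exec _ _) fun _ =>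
      timeLE_bind (timeLE_exec _ _) fun _ => timeLE_bind (timeLE_pcLoop hS _ _ _) fun _ =>
      timeLE_pure _
  refine h1.mono ?_
  have hd' : (d : ℝ) ≤ nnz A := Nat.cast_le.2 hd
  have hA' : (1 : ℝ) ≤ nnz A := by exact_mod_cast hA
  -- The setup costs `17 + 2d + 4 nnz ≤ 23 nnz` besides the call. A pass may then use `46 nnz`, of
  -- which `8 nnz` go to products with `Aᵀ A`; `38` is the remainder.
  have hq := mul_le_mul_of_nonneg_left (by linarith : 3 * (d : ℝ) + 6 ≤ 38 * nnz A)
    (Nat.cast_nonneg (iters c₁ ε γ) : (0 : ℝ) ≤ _)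
  push_cast
  linarith

theorem callsEq_softProj (ridge : RidgeProc n d) (ε δ : ℝ) (x : Vec d) :
    (softProj ridge A lam ε δ x).CallsEq 1 :=
  callsEq_bind (a := 0) (callsEq_bind (callsEq_exec _ _) fun _ => callsEq_exec _ _)
    fun _ => callsEq_call _

theorem callsEq_pcLoop {R : Vec d → Comp (Vec d)} (h : ∀ x, (R x).CallsEq 1) (s w : Vec d)
    (k : ℕ) : (pcLoop R s w k).CallsEq (2 * k) := by
  induction k with
  | zero => exact callsEq_pure _
  | succ k ih =>
    exact callsEq_bind ih fun _ => callsEq_bind (h _) fun _ => callsEq_bind (callsEq_exec _ _)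
      fun _ => callsEq_bind (h _) fun _ => callsEq_bind (callsEq_exec _ _) fun _ =>
      callsEq_bind (callsEq_exec _ _) fun _ => callsEq_bind (callsEq_exec _ _) fun _ =>
      callsEq_pure _

theorem callsEq_pcProj (ridge : RidgeProc n d) (c₁ c₂ : ℝ) (y : Vec d) (ε δ γ : ℝ) :
    (pcProj ridge c₁ c₂ A y ε δ lam γ).CallsEq (2 * iters c₁ ε γ + 1) := by
  rw [Nat.add_comm]
  exact callsEq_exec_bind <| callsEq_exec_bind <| callsEq_exec_bind <|
    callsEq_bind (callsEq_softProj A ridge _ _ y) fun _ => callsEq_exec_bind <|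
    callsEq_exec_bind <| callsEq_bind (callsEq_pcLoop (callsEq_softProj A ridge _ _) _ _ _)
    fun _ => callsEq_pure _

theorem timeLE_ridgeGrad (y x : Vec d) : (ridgeGrad A lam y x).TimeLE (4 * nnz A + 3 * d) :=
  (timeLE_bind (timeLE_gramVec A x) fun _ => timeLE_bind (timeLE_exec _ _) fun _ =>
    timeLE_bind (timeLE_exec _ _) fun _ => timeLE_exec _ _).mono (le_of_eq (by ring))

theorem timeLE_agdLoop (L β : ℝ) (y : Vec d) (t : ℕ) :
    (agdLoop A lam L β y t).TimeLE (d + t * (4 * nnz A + 8 * d)) := by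
  induction t with
  | zero => exact (timeLE_exec _ _).mono (by simp)
  | succ t ih =>
    refine (timeLE_bind ih fun _ => timeLE_bind (timeLE_ridgeGrad A _ _) fun _ =>
      timeLE_bind (timeLE_exec _ _) fun _ => timeLE_bind (timeLE_exec _ _) fun _ =>
      timeLE_bind (timeLE_exec _ _) fun _ => timeLE_bind (timeLE_exec _ _) fun _ =>
      timeLE_bind (timeLE_exec _ _) fun _ => timeLE_pure _).mono (le_of_eq ?_)
    push_cast
    ring

theorem timeLE_agdRidge (y : Vec d) (ε δ : ℝ) :
    (agdRidge n d A lam y ε δ).TimeLE (14 + d +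
      ⌈2 * √((sigma A 1 ^ 2 + lam) / lam) * Real.log (2 / ε)⌉₊ * (4 * nnz A + 8 * d)) := by
  have h : (agdRidge n d A lam y ε δ).TimeLE _ :=
    timeLE_exec_bind <| timeLE_exec_bind <| timeLE_exec_bind <|
      timeLE_bind (timeLE_agdLoop A _ _ y _) fun _ => timeLE_pure _
  refine h.mono (le_of_eq ?_)
  push_cast
  ring

theorem timeLE_svrgInner (hA : A ≠ 0) (F η : ℝ) (c G : Vec d) (t : ℕ) :
    (svrgInner A hA lam F η c G t).TimeLE (d + t * (10 * d + 3)) := by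
  induction t with
  | zero => exact (timeLE_exec _ _).mono (by simp)
  | succ t ih =>
    refine (timeLE_bind ih fun _ => timeLE_bind (timeLE_exec _ _) fun _ =>
      timeLE_bind (timeLE_draw _) fun _ => timeLE_bind (timeLE_exec _ _) fun _ =>
      timeLE_bind (timeLE_exec _ _) fun _ => timeLE_bind (timeLE_exec _ _) fun _ =>
      timeLE_bind (timeLE_exec _ _) fun _ => timeLE_bind (timeLE_exec _ _) fun _ =>
      timeLE_bind (timeLE_exec _ _) fun _ => timeLE_bind (timeLE_exec _ _) fun _ =>
      timeLE_bind (timeLE_exec _ _) fun _ => timeLE_bind (timeLE_exec _ _) fun _ =>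
      timeLE_pure _).mono (le_of_eq ?_)
    push_cast
    ring

theorem timeLE_svrgEpochs (hA : A ≠ 0) (F η : ℝ) (m : ℕ) (y : Vec d) (k : ℕ) :
    (svrgEpochs A hA lam F η m y k).TimeLE
      (d + k * (4 * nnz A + 5 * d + m * (10 * d + 3))) := by
  induction k with
  | zero => exact (timeLE_exec _ _).mono (by simp)
  | succ k ih =>
    refine (timeLE_bind ih fun _ => timeLE_bind (timeLE_ridgeGrad A _ _) fun _ =>
      timeLE_bind (timeLE_svrgInner A hA _ _ _ _ _) fun _ => timeLE_exec _ _).mono (le_of_eq ?_)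
    push_cast
    ring

theorem timeLE_svrgRidge (hA : A ≠ 0) (y : Vec d) (ε δ : ℝ) :
    (svrgRidge n d A lam y ε δ).TimeLE (10 * nnz A + 13 + d +
      ⌈Real.logb 2 (1 / (ε ^ 2 * δ))⌉₊ *
        (4 * nnz A + 5 * d + ⌈16 * (frobSq A + lam) / lam⌉₊ * (10 * d + 3))) := by
  have h : (svrgRidge n d A lam y ε δ).TimeLE (((10 * nnz A : ℕ) : ℝ) + ((3 : ℕ) + ((4 : ℕ) +
      ((6 : ℕ) + (d + ⌈Real.logb 2 (1 / (ε ^ 2 * δ))⌉₊ *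
        (4 * nnz A + 5 * d + ⌈16 * (frobSq A + lam) / lam⌉₊ * (10 * d + 3))))))) := by
    rw [svrgRidge, dif_neg hA]
    exact timeLE_exec_bind <| timeLE_exec_bind <| timeLE_exec_bind <| timeLE_exec_bind <|
      timeLE_svrgEpochs A hA _ _ _ y _
  refine h.mono (le_of_eq ?_)
  push_cast
  ring

end Time

/-! ### Logarithmic bounds -/

section Bounds

variable {n d : ℕ} {A : Matrix (Fin n) (Fin d) ℝ} {lam γ : ℝ} {c₁ c₂ ε δ : ℝ} {y : Vec d}

theorem half_le_log_inv (hε0 : 0 < ε) (hε : ε ≤ 1 / 2) : 1 / 2 ≤ Real.log (1 / ε) := by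
  have h1 : (2 : ℝ) ≤ 1 / ε := by
    rw [le_div_iff₀ hε0]
    linarith
  have h2 := Real.log_le_log two_pos h1
  linarith [Real.log_two_gt_d9]

theorem one_le_log_inv (hγ0 : 0 < γ) (hγ : γ < 1 / 4) : 1 ≤ Real.log (1 / γ) := by
  rw [Real.le_log_iff_exp_le (by positivity), le_div_iff₀ hγ0]
  nlinarith [Real.exp_one_lt_d9, Real.exp_pos 1]

theorem iters_le (hc₁ : 24 ≤ c₁) (hε0 : 0 < ε) (hε : ε ≤ 1 / 2) (hγ0 : 0 < γ) (hγ : γ < 1 / 4) :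
    2 * (iters c₁ ε γ : ℝ) + 1 ≤ (2 * c₁ + 1) * (γ⁻¹ ^ 2 * Real.log (1 / ε)) := by
  have hL := half_le_log_inv hε0 hε
  have hg : 4 ≤ γ⁻¹ := by
    rw [← one_div, le_div_iff₀ hγ0]
    linarith
  have hg2 : 16 ≤ γ⁻¹ ^ 2 := by nlinarith
  -- Rounding up contributes at most `2 · 1 + 1 = 3` to `2q + 1`, absorbed by one more copy of this
  -- quantity.
  have hgL : 3 ≤ γ⁻¹ ^ 2 * Real.log (1 / ε) := by nlinarith
  have h : (iters c₁ ε γ : ℝ) < c₁ * γ⁻¹ ^ 2 * Real.log (1 / ε) + 1 :=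
    Nat.ceil_lt_add_one (by positivity)
  linarith

theorem log_kappa_div (hκ : 0 < kappa A lam) (hε0 : 0 < ε) (hγ0 : 0 < γ) :
    Real.log (kappa A lam / (ε * γ)) =
      Real.log (kappa A lam) + Real.log (1 / ε) + Real.log (1 / γ) := by
  rw [Real.log_div hκ.ne' (by positivity), Real.log_mul hε0.ne' hγ0.ne', one_div, one_div,
    Real.log_inv, Real.log_inv]
  ring

theorem log_inv_innerEps_le (hc₂ : 24 ≤ c₂) (hκ : 1 ≤ kappa A lam) (hε0 : 0 < ε)
    (hε : ε ≤ 1 / 2) (hγ0 : 0 < γ) (hγ : γ < 1 / 4) :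
    Real.log (1 / innerEps c₂ A lam ε γ) ≤ (c₂ + 2) * Real.log (kappa A lam / (ε * γ)) := by
  have hκ0 : 0 < kappa A lam := by linarith
  have hc₂0 : 0 < c₂ := by linarith
  have h1 : Real.log (1 / innerEps c₂ A lam ε γ) = Real.log c₂ + Real.log (kappa A lam) / 2 +
      2 * Real.log (1 / ε) + 2 * Real.log (1 / γ) := by
    rw [one_div, Real.log_inv, innerEps, Real.log_div (by positivity) (by positivity),
      Real.log_mul (by positivity) (by positivity), Real.log_mul (by positivity) (by positivity),
      Real.log_sqrt hκ0.le, Real.log_pow, Real.log_pow, Real.log_inv, one_div, one_div,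
      Real.log_inv, Real.log_inv]
    push_cast
    ring
  have h2 := half_le_log_inv hε0 hε
  have h3 := one_le_log_inv hγ0 hγ
  have h4 := Real.log_nonneg hκ
  have h5 := Real.log_le_self hc₂0.le
  rw [h1, log_kappa_div hκ0 hε0 hγ0]
  nlinarith

/-- Since `1/δ' = (2q+1)/δ`, the new term is `log(2q+1)`; by `iters_le` it is at most a constant
plus `2 log(1/γ)` plus `log log(1/ε)`, and `log x ≤ x` disposes of the last. -/
theorem log_inv_innerDelta_mul_innerEps_le (hc₁ : 24 ≤ c₁) (hc₂ : 24 ≤ c₂)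
    (hκ : 1 ≤ kappa A lam) (hε0 : 0 < ε) (hε : ε ≤ 1 / 2) (hγ0 : 0 < γ) (hγ : γ < 1 / 4)
    (hδ0 : 0 < δ) (hδ1 : δ < 1) :
    Real.log (1 / (innerDelta c₁ ε δ γ * innerEps c₂ A lam ε γ)) ≤
      (2 * c₁ + c₂ + 6) * Real.log (kappa A lam / (ε * γ * δ)) ∧
    Real.log (kappa A lam / (ε * γ)) ≤ Real.log (kappa A lam / (ε * γ * δ)) := by
  have hκ0 : 0 < kappa A lam := by linarith
  have hc₂0 : 0 < c₂ := by linarith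
  have hL := half_le_log_inv hε0 hε
  have hε' : 0 < innerEps c₂ A lam ε γ := by rw [innerEps]; positivity
  have hδ' : 0 < innerDelta c₁ ε δ γ := by rw [innerDelta]; positivity
  have h1 : Real.log (1 / (innerDelta c₁ ε δ γ * innerEps c₂ A lam ε γ)) =
      Real.log (1 / innerEps c₂ A lam ε γ) + Real.log (2 * (iters c₁ ε γ : ℝ) + 1) +
        Real.log (1 / δ) := by
    rw [one_div, Real.log_inv, Real.log_mul hδ'.ne' hε'.ne', innerDelta,
      Real.log_div hδ0.ne' (by positivity), one_div, one_div, Real.log_inv, Real.log_inv]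
    ring
  have h2 := log_inv_innerEps_le hc₂ hκ hε0 hε hγ0 hγ
  have h3 := one_le_log_inv hγ0 hγ
  have h4 := Real.log_nonneg hκ
  have h5 : Real.log (2 * (iters c₁ ε γ : ℝ) + 1) ≤
      (2 * c₁ + 1) + 2 * Real.log (1 / γ) + Real.log (1 / ε) := by
    refine (Real.log_le_log (by positivity) (iters_le hc₁ hε0 hε hγ0 hγ)).trans ?_
    rw [Real.log_mul (by positivity) (by positivity), Real.log_mul (by positivity) (by positivity),
      Real.log_pow, ← one_div]
    have h6 := Real.log_le_self (by linarith : 0 ≤ 2 * c₁ + 1)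
    have h7 := Real.log_le_self (by linarith : 0 ≤ Real.log (1 / ε))
    push_cast
    linarith
  have h6 : Real.log (kappa A lam / (ε * γ * δ)) =
      Real.log (kappa A lam / (ε * γ)) + Real.log (1 / δ) := by
    rw [← div_div, Real.log_div (by positivity) hδ0.ne', one_div, Real.log_inv]
    ring
  have h7 : 0 ≤ Real.log (1 / δ) := Real.log_nonneg (by rw [le_div_iff₀ hδ0]; linarith)
  rw [h1, h6]
  refine ⟨?_, by linarith⟩
  have h8 := log_kappa_div hκ0 hε0 hγ0
  set Λ := Real.log (kappa A lam / (ε * γ))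
  have h9 : 1 ≤ Λ := by linarith
  nlinarith

theorem one_le_log_kappa_div (hκ : 1 ≤ kappa A lam) (hε0 : 0 < ε) (hε : ε ≤ 1 / 2) (hγ0 : 0 < γ)
    (hγ : γ < 1 / 4) : 1 ≤ Real.log (kappa A lam / (ε * γ)) := by
  have h2 := half_le_log_inv hε0 hε
  have h3 := one_le_log_inv hγ0 hγ
  have h4 := Real.log_nonneg hκ
  rw [log_kappa_div (by linarith) hε0 hγ0]
  linarith

/-- If every ridge regression call takes time `B X Λ`, then `pcProj` takes time
`O(X γ⁻² log(1/ε) Λ)`. -/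
theorem timeLE_pcProj_of_le (hc₁ : 24 ≤ c₁) (hε0 : 0 < ε) (hε : ε ≤ 1 / 2) (hγ0 : 0 < γ)
    (hγ : γ < 1 / 4) (hd : d ≤ nnz A) (hA : 1 ≤ nnz A) {ridge : RidgeProc n d} {T B X Λ K : ℝ}
    (h : ∀ x, (ridge A lam x (innerEps c₂ A lam ε γ) (innerDelta c₁ ε δ γ)).TimeLE T)
    (hX : nnz A ≤ X) (hΛ : 1 ≤ Λ) (hT : T ≤ B * (X * Λ)) (hB : 0 ≤ B)
    (hK : (2 * c₁ + 1) * (B + 23) ≤ K) :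
    (pcProj ridge c₁ c₂ A y ε δ lam γ).TimeLE
      (K * (X * γ⁻¹ ^ 2 * Real.log (1 / ε) * Λ)) := by
  refine (timeLE_pcProj A hd hA y h).mono ?_
  have h1 := iters_le hc₁ hε0 hε hγ0 hγ
  have hL := half_le_log_inv hε0 hε
  have hX0 : 0 ≤ X := (Nat.cast_nonneg _).trans hX
  have h2 : (nnz A : ℝ) ≤ X * Λ := hX.trans (le_mul_of_one_le_right hX0 hΛ)
  have h3 : T + 23 * nnz A ≤ (B + 23) * (X * Λ) := by linarith
  have hXΛ : 0 ≤ X * Λ := by positivity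
  have hgL : 0 ≤ γ⁻¹ ^ 2 * Real.log (1 / ε) := by positivity
  calc (2 * (iters c₁ ε γ : ℝ) + 1) * (T + 23 * nnz A)
      ≤ (2 * (iters c₁ ε γ : ℝ) + 1) * ((B + 23) * (X * Λ)) := by gcongr
    _ ≤ (2 * c₁ + 1) * (γ⁻¹ ^ 2 * Real.log (1 / ε)) * ((B + 23) * (X * Λ)) :=
        mul_le_mul_of_nonneg_right h1 (by positivity)
    _ = (2 * c₁ + 1) * (B + 23) * ((X * Λ) * (γ⁻¹ ^ 2 * Real.log (1 / ε))) := by ring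
    _ ≤ K * ((X * Λ) * (γ⁻¹ ^ 2 * Real.log (1 / ε))) :=
        mul_le_mul_of_nonneg_right hK (by positivity)
    _ = _ := by ring

/-- With `d ≤ nnz A` a step costs at most `12 nnz A`, and there are at most `(4c₂ + 13) √κ Λ` steps;
the setup adds `15 nnz A`, so the constant is `12(4c₂ + 13) + 15`. -/
theorem agd_time_le (hc₂ : 24 ≤ c₂) (hlam : 0 < lam) (hκ : 1 ≤ kappa A lam) (hε0 : 0 < ε)
    (hε : ε ≤ 1 / 2) (hγ0 : 0 < γ) (hγ : γ < 1 / 4) (hd : d ≤ nnz A) (hA : 1 ≤ nnz A) :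
    (14 + d + ⌈2 * √((sigma A 1 ^ 2 + lam) / lam) *
      Real.log (2 / innerEps c₂ A lam ε γ)⌉₊ * (4 * nnz A + 8 * d) : ℝ) ≤
      (48 * c₂ + 171) * (nnz A * √(kappa A lam) * Real.log (kappa A lam / (ε * γ))) := by
  have hκ0 : 0 < kappa A lam := by linarith
  have hc₂0 : 0 < c₂ := by linarith
  have hε' : 0 < innerEps c₂ A lam ε γ := by rw [innerEps]; positivity
  have hΛ := one_le_log_kappa_div hκ hε0 hε hγ0 hγ
  have h1 := log_inv_innerEps_le hc₂ hκ hε0 hε hγ0 hγ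
  have h2 : Real.log (2 / innerEps c₂ A lam ε γ) ≤
      (c₂ + 3) * Real.log (kappa A lam / (ε * γ)) := by
    rw [div_eq_mul_one_div, Real.log_mul two_ne_zero (by positivity)]
    linarith [Real.log_two_lt_d9]
  have h3 : √((sigma A 1 ^ 2 + lam) / lam) ≤ 2 * √(kappa A lam) := by
    rw [add_div, div_self hlam.ne', ← kappa, Real.sqrt_le_left (by positivity), mul_pow,
      Real.sq_sqrt hκ0.le]
    linarith
  set Λ := Real.log (kappa A lam / (ε * γ))
  set s := √(kappa A lam)
  have hs : 1 ≤ s := by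
    rw [← Real.sqrt_one]
    exact Real.sqrt_le_sqrt hκ
  have h4 : 2 * √((sigma A 1 ^ 2 + lam) / lam) * Real.log (2 / innerEps c₂ A lam ε γ) ≤
      (4 * c₂ + 12) * (s * Λ) := by
    calc _ ≤ 2 * √((sigma A 1 ^ 2 + lam) / lam) * ((c₂ + 3) * Λ) := by gcongr
      _ ≤ 2 * (2 * s) * ((c₂ + 3) * Λ) := by gcongr
      _ = _ := by ring
  have h5 := (Nat.cast_le (α := ℝ)).2 (Nat.ceil_le_ceil h4)
  have h6 := Nat.ceil_lt_add_one (by positivity : 0 ≤ (4 * c₂ + 12) * (s * Λ))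
  have hsΛ : 1 ≤ s * Λ := one_le_mul_of_one_le_of_one_le hs hΛ
  set N := ⌈2 * √((sigma A 1 ^ 2 + lam) / lam) * Real.log (2 / innerEps c₂ A lam ε γ)⌉₊
  have h7 : (N : ℝ) ≤ (4 * c₂ + 13) * (s * Λ) := by linarith
  have hd' : (d : ℝ) ≤ nnz A := Nat.cast_le.2 hd
  have hA' : (1 : ℝ) ≤ nnz A := by exact_mod_cast hA
  calc (14 + d + N * (4 * nnz A + 8 * d) : ℝ)
      ≤ 14 * nnz A + nnz A + (4 * c₂ + 13) * (s * Λ) * (4 * nnz A + 8 * nnz A) := by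
        gcongr
        linarith
    _ ≤ 15 * nnz A * (s * Λ) + (4 * c₂ + 13) * (s * Λ) * (4 * nnz A + 8 * nnz A) := by
        have := le_mul_of_one_le_right (by positivity : (0 : ℝ) ≤ 15 * nnz A) hsΛ
        linarith
    _ = _ := by ring

theorem svrg_time_le (hc₁ : 24 ≤ c₁) (hc₂ : 24 ≤ c₂) (hlam : 0 < lam) (hκ : 1 ≤ kappa A lam)
    (hε0 : 0 < ε) (hε : ε ≤ 1 / 2) (hγ0 : 0 < γ) (hγ : γ < 1 / 4) (hδ0 : 0 < δ) (hδ1 : δ < 1)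
    (hd : d ≤ nnz A) (hA : 1 ≤ nnz A) (hd1 : 1 ≤ d) :
    (10 * nnz A + 13 + d + ⌈Real.logb 2 (1 / (innerEps c₂ A lam ε γ ^ 2 * innerDelta c₁ ε δ γ))⌉₊ *
        (4 * nnz A + 5 * d + ⌈16 * (frobSq A + lam) / lam⌉₊ * (10 * d + 3)) : ℝ) ≤
      (24 + 230 * (4 * c₁ + 4 * c₂ + 17)) * ((nnz A + d * stableRank A * kappa A lam) *
        Real.log (kappa A lam / (ε * γ * δ))) := by
  have hκ0 : 0 < kappa A lam := by linarith
  have hc₂0 : 0 < c₂ := by linarith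
  have hε' : 0 < innerEps c₂ A lam ε γ := by rw [innerEps]; positivity
  have hδ' : 0 < innerDelta c₁ ε δ γ := by rw [innerDelta]; positivity
  have hΛ := one_le_log_kappa_div hκ hε0 hε hγ0 hγ
  have h1 := log_inv_innerEps_le hc₂ hκ hε0 hε hγ0 hγ
  obtain ⟨h2, h3⟩ := log_inv_innerDelta_mul_innerEps_le hc₁ hc₂ hκ hε0 hε hγ0 hγ hδ0 hδ1
  set Λ := Real.log (kappa A lam / (ε * γ))
  set Λδ := Real.log (kappa A lam / (ε * γ * δ))
  have h4 : Real.log (1 / (innerEps c₂ A lam ε γ ^ 2 * innerDelta c₁ ε δ γ)) ≤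
      (2 * c₁ + 2 * c₂ + 8) * Λδ := by
    have h5 : 1 / (innerEps c₂ A lam ε γ ^ 2 * innerDelta c₁ ε δ γ) =
        1 / innerEps c₂ A lam ε γ * (1 / (innerDelta c₁ ε δ γ * innerEps c₂ A lam ε γ)) := by
      field_simp
    rw [h5, Real.log_mul (by positivity) (by positivity)]
    have := mul_le_mul_of_nonneg_left h3 (by linarith : 0 ≤ c₂ + 2)
    linarith
  have h5 : Real.logb 2 (1 / (innerEps c₂ A lam ε γ ^ 2 * innerDelta c₁ ε δ γ)) ≤
      (4 * c₁ + 4 * c₂ + 16) * Λδ := by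
    rw [Real.logb, div_le_iff₀ (Real.log_pos one_lt_two)]
    have h6 := Real.log_two_gt_d9
    have h7 : 0 ≤ (2 * c₁ + 2 * c₂ + 8) * Λδ := mul_nonneg (by linarith) (by linarith)
    nlinarith
  have h6 := (Nat.cast_le (α := ℝ)).2 (Nat.ceil_le_ceil h5)
  have h7 := Nat.ceil_lt_add_one (by
    have : 0 ≤ Λδ := by linarith
    positivity : 0 ≤ (4 * c₁ + 4 * c₂ + 16) * Λδ)
  set E := ⌈Real.logb 2 (1 / (innerEps c₂ A lam ε γ ^ 2 * innerDelta c₁ ε δ γ))⌉₊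
  have h8 : (E : ℝ) ≤ (4 * c₁ + 4 * c₂ + 17) * Λδ := by linarith
  have hF : 0 ≤ frobSq A := Finset.sum_nonneg fun i _ => rowSq_nonneg A i
  have hσ : sigma A 1 ≠ 0 := by
    intro h
    rw [kappa, h, zero_pow two_ne_zero, zero_div] at hκ0
    exact lt_irrefl _ hκ0
  -- The largest singular value cancels from the stable rank times `κ`, leaving the ratio `‖A‖_F²/λ`
  -- that determines the epoch length.
  have h9 : (d : ℝ) * stableRank A * kappa A lam = d * (frobSq A / lam) := by
    rw [stableRank, kappa]
    field_simp
  have h10 := Nat.ceil_lt_add_one (by positivity : 0 ≤ 16 * (frobSq A + lam) / lam)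
  set m := ⌈16 * (frobSq A + lam) / lam⌉₊
  have h11 : (m : ℝ) ≤ 16 * (frobSq A / lam) + 17 := by
    have : 16 * (frobSq A + lam) / lam = 16 * (frobSq A / lam) + 16 := by field_simp
    linarith
  have hd' : (d : ℝ) ≤ nnz A := Nat.cast_le.2 hd
  have hd1' : (1 : ℝ) ≤ d := by exact_mod_cast hd1
  have hA' : (1 : ℝ) ≤ nnz A := by exact_mod_cast hA
  rw [h9]
  set X : ℝ := nnz A + d * (frobSq A / lam) with hX
  have hdF : 0 ≤ (d : ℝ) * (frobSq A / lam) := by positivity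
  -- The coefficients are `4 + 5 + 17 · 13 = 230` for `nnz A` and `16 · 13 = 208` for `d‖A‖_F²/λ`.
  have h12 : (4 * nnz A + 5 * d + m * (10 * d + 3) : ℝ) ≤ 230 * X := by
    have h13 : (m : ℝ) * (10 * d + 3) ≤ (16 * (frobSq A / lam) + 17) * (13 * d) := by
      gcongr
      linarith
    rw [hX]
    linarith
  have hX0 : 0 ≤ X := by positivity
  have h14 : (E : ℝ) * (4 * nnz A + 5 * d + m * (10 * d + 3)) ≤
      (4 * c₁ + 4 * c₂ + 17) * Λδ * (230 * X) :=
    mul_le_mul h8 h12 (by positivity) ((Nat.cast_nonneg _).trans h8)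
  have h15 : X ≤ X * Λδ := le_mul_of_one_le_right hX0 (by linarith)
  have h16 : (nnz A : ℝ) ≤ X := by linarith
  linarith

end Bounds

/-! ### Zero and nonzero matrices. -/

theorem sigma_zero_matrix {n d : ℕ} (i : ℕ) : sigma (0 : Matrix (Fin n) (Fin d) ℝ) i = 0 := by
  rw [sigma, map_zero, LinearMap.singularValues_zero]
  rfl

theorem one_le_nnz {n d : ℕ} {A : Matrix (Fin n) (Fin d) ℝ} (hA : A ≠ 0) : 1 ≤ nnz A := by
  rw [nnz, Nat.one_le_iff_ne_zero, ← Nat.pos_iff_ne_zero, Set.ncard_pos (Set.toFinite _)]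
  by_contra h
  apply hA
  ext i j
  by_contra hij
  exact h ⟨(i, j), hij⟩

end PCP

end

/-! ### The main theorem. -/

open PCP in
theorem mainTheorem1 :
    -- sufficiently large constants of the algorithm
    ∃ C : ℝ, 0 < C ∧ ∀ c₁ c₂ : ℝ, C ≤ c₁ → C ≤ c₂ →
    -- the constant in all the bounds of the form `O(·)`
    ∃ K : ℝ, 0 < K ∧
    ∀ (n d : ℕ) (A : Matrix (Fin n) (Fin d) ℝ) (y : Vec d) (ε δ lam γ : ℝ) (k : ℕ),
      0 < ε → ε < 1 → 0 < δ → δ < 1 → 0 < lam → 0 < γ → γ < 1 / 4 → 1 ≤ k →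
      1 / (1 - 4 * γ) * sigma A (k + 1) ^ 2 ≤ lam →
      lam ≤ (1 - 4 * γ) * sigma A k ^ 2 →
      -- any ridge regression solver as subroutine: accuracy
      (∀ ridge : RidgeProc n d, IsRidgeSolver ridge A lam →
        1 - ENNReal.ofReal δ ≤ (pcProj ridge c₁ c₂ A y ε δ lam γ).prob
          (fun s => ‖s - mulE (topProj A lam) y‖ ≤ ε * ‖y‖)) ∧
      (∀ ridge : RidgeProc n d, IsSureRidgeSolver ridge A lam →
        (pcProj ridge c₁ c₂ A y ε δ lam γ).Surely
          (fun o => ‖o.value - mulE (topProj A lam) y‖ ≤ ε * ‖y‖)) ∧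
      -- number of ridge regression calls, each with accuracy `ε'` and failure rate `δ'`
      (∀ ridge : RidgeProc n d,
        (pcProj ridge c₁ c₂ A y ε δ lam γ).Surely
          (fun o => o.calls = 2 * iters c₁ ε γ + 1)) ∧
      (ε ≤ 1 / 2 →
        2 * (iters c₁ ε γ : ℝ) + 1 ≤ K * (γ⁻¹ ^ 2 * Real.log (1 / ε))) ∧
      -- running times
      (d ≤ nnz A →
        (∀ (ridge : RidgeProc n d) (T : ℝ), 0 ≤ T →
          (∀ x : Vec d,
            (ridge A lam x (innerEps c₂ A lam ε γ) (innerDelta c₁ ε δ γ)).TimeLE T) →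
          (pcProj ridge c₁ c₂ A y ε δ lam γ).TimeLE
            ((2 * (iters c₁ ε γ : ℝ) + 1) * (T + K * nnz A))) ∧
        (ε ≤ 1 / 2 →
          -- subroutines with running time `W log(1/ε)`
          (∀ (ridge : RidgeProc n d) (W : ℝ), 0 ≤ W →
            (∀ x : Vec d,
              (ridge A lam x (innerEps c₂ A lam ε γ) (innerDelta c₁ ε δ γ)).TimeLE
                (W * Real.log (1 / innerEps c₂ A lam ε γ))) →
            (pcProj ridge c₁ c₂ A y ε δ lam γ).TimeLE
              (K * ((nnz A + W) * γ⁻¹ ^ 2 * Real.log (1 / ε)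
                * Real.log (kappa A lam / (ε * γ))))) ∧
          -- subroutines with running time `W log(1/(δε))`
          (∀ (ridge : RidgeProc n d) (W : ℝ), 0 ≤ W →
            (∀ x : Vec d,
              (ridge A lam x (innerEps c₂ A lam ε γ) (innerDelta c₁ ε δ γ)).TimeLE
                (W * Real.log (1 / (innerDelta c₁ ε δ γ * innerEps c₂ A lam ε γ)))) →
            (pcProj ridge c₁ c₂ A y ε δ lam γ).TimeLE
              (K * ((nnz A + W) * γ⁻¹ ^ 2 * Real.log (1 / ε)
                * Real.log (kappa A lam / (ε * γ * δ))))) ∧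
          -- accelerated gradient descent as subroutine, no failure probability
          ((pcProj (agdRidge n d) c₁ c₂ A y ε δ lam γ).Surely
              (fun o => ‖o.value - mulE (topProj A lam) y‖ ≤ ε * ‖y‖) ∧
            (pcProj (agdRidge n d) c₁ c₂ A y ε δ lam γ).TimeLE
              (K * (nnz A * √(kappa A lam) * γ⁻¹ ^ 2 * Real.log (1 / ε)
                * Real.log (kappa A lam / (ε * γ))))) ∧
          -- stochastic gradient descent as subroutine
          (1 - ENNReal.ofReal δ ≤ (pcProj (svrgRidge n d) c₁ c₂ A y ε δ lam γ).prob
              (fun s => ‖s - mulE (topProj A lam) y‖ ≤ ε * ‖y‖) ∧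
            (pcProj (svrgRidge n d) c₁ c₂ A y ε δ lam γ).TimeLE
              (K * ((nnz A + d * stableRank A * kappa A lam) * γ⁻¹ ^ 2 * Real.log (1 / ε)
                * Real.log (kappa A lam / (ε * γ * δ))))))) := by
  refine ⟨24, by norm_num, fun c₁ c₂ hc₁ hc₂ => ?_⟩
  have hK1 : 0 ≤ 2 * c₁ + 1 := by linarith
  -- Chosen to dominate the per-call constants of all four running-time bounds, the largest being
  -- `24 + 230 (4c₁ + 4c₂ + 17)`.
  set B : ℝ := 300 * (4 * c₁ + 4 * c₂ + 17) with hB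
  refine ⟨(2 * c₁ + 1) * (B + 23), by rw [hB]; positivity, ?_⟩
  intro n d A y ε δ lam γ k hε0 hε1 hδ0 hδ1 hlam hγ0 hγ hk h1 h2
  -- The upper gap condition gives `λ ≤ σ_k² ≤ σ_1²`; hence `κ ≥ 1`, `A ≠ 0` and `d ≥ 1`, which all
  -- the bounds need.
  have hσ : lam ≤ sigma A 1 ^ 2 := by
    have h3 := pow_le_pow_left₀ (sigma_nonneg A k) (sigma_anti A hk) 2
    have h4 := mul_le_mul_of_nonneg_right (by linarith : 1 - 4 * γ ≤ 1) (sq_nonneg (sigma A k))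
    linarith
  have hκ : 1 ≤ kappa A lam := (one_le_div hlam).2 hσ
  have hκ0 : 0 < kappa A lam := by linarith
  have hA : A ≠ 0 := by
    rintro rfl
    rw [sigma_zero_matrix] at hσ
    norm_num at hσ
    linarith
  have hnnz := one_le_nnz hA
  have hd1 : 1 ≤ d := by
    rcases Nat.eq_zero_or_pos d with rfl | hd
    · exact absurd (by ext i j; exact j.elim0) hA
    · exact hd
  have hε' : 0 < innerEps c₂ A lam ε γ := by
    have : 0 < c₂ := by linarith
    rw [innerEps]
    positivity
  have hδ' : 0 < innerDelta c₁ ε δ γ := by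
    rw [innerDelta]
    positivity
  have hprob : ∀ ridge : RidgeProc n d, IsRidgeSolver ridge A lam →
      1 - ENNReal.ofReal δ ≤ (pcProj ridge c₁ c₂ A y ε δ lam γ).prob
        (fun s => ‖s - mulE (topProj A lam) y‖ ≤ ε * ‖y‖) := by
    intro ridge hr
    rw [Comp.le_prob_iff]
    refine (fail_pcProj_le hc₁ hc₂ hε0 hε1 hlam hκ0 hγ0 hγ h1 h2
      (D := ENNReal.ofReal (innerDelta c₁ ε δ γ)) fun z =>
      (Comp.le_prob_iff _ _ _).1 (hr z _ _ hε' hδ')).trans (le_of_eq ?_)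
    rw [← ENNReal.ofReal_natCast, ← ENNReal.ofReal_mul (by positivity), innerDelta]
    congr 1
    push_cast
    field_simp
  have hsure : ∀ ridge : RidgeProc n d,
      (∀ z, Comp.fail (ridge A lam z (innerEps c₂ A lam ε γ) (innerDelta c₁ ε δ γ))
        (RidgeApprox A lam z (innerEps c₂ A lam ε γ)) = 0) →
      (pcProj ridge c₁ c₂ A y ε δ lam γ).Surely
        (fun o => ‖o.value - mulE (topProj A lam) y‖ ≤ ε * ‖y‖) := by
    intro ridge hr
    refine (Comp.surely_iff_fail _ fun s => ‖s - mulE (topProj A lam) y‖ ≤ ε * ‖y‖).2 ?_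
    have h3 := fail_pcProj_le (y := y) hc₁ hc₂ hε0 hε1 hlam hκ0 hγ0 hγ h1 h2 fun z => (hr z).le
    rwa [mul_zero, nonpos_iff_eq_zero] at h3
  refine ⟨hprob, fun ridge hr => hsure ridge fun z =>
      (Comp.surely_iff_fail _ (RidgeApprox A lam z _)).1 (hr z _ _ hε' hδ'),
    fun ridge => callsEq_pcProj A ridge c₁ c₂ y ε δ γ,
    fun hε => ?_, fun hd => ⟨fun ridge T _ hT => ?_, fun hε => ?_⟩⟩
  · have h3 := iters_le hc₁ hε0 hε hγ0 hγ
    have hL := half_le_log_inv hε0 hε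
    refine h3.trans (mul_le_mul_of_nonneg_right (le_mul_of_one_le_right hK1 ?_) (by positivity))
    rw [hB]
    linarith
  · refine (timeLE_pcProj A hd hnnz y hT).mono (mul_le_mul_of_nonneg_left ?_ (by positivity))
    refine add_le_add le_rfl (mul_le_mul_of_nonneg_right ?_ (Nat.cast_nonneg _))
    nlinarith
  · have hΛ := one_le_log_kappa_div hκ hε0 hε hγ0 hγ
    have hE := log_inv_innerEps_le hc₂ hκ hε0 hε hγ0 hγ
    obtain ⟨hD, hΛδ⟩ := log_inv_innerDelta_mul_innerEps_le hc₁ hc₂ hκ hε0 hε hγ0 hγ hδ0 hδ1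
    have hnn : (0 : ℝ) ≤ nnz A := Nat.cast_nonneg _
    have hKle : ∀ b : ℝ, b ≤ B → (2 * c₁ + 1) * (b + 23) ≤ (2 * c₁ + 1) * (B + 23) :=
      fun b hb => mul_le_mul_of_nonneg_left (by linarith) hK1
    refine ⟨fun ridge W hW hT => ?_, fun ridge W hW hT => ?_, ⟨?_, ?_⟩, ⟨?_, ?_⟩⟩
    · refine timeLE_pcProj_of_le hc₁ hε0 hε hγ0 hγ hd hnnz hT (B := c₂ + 2) (by linarith) hΛ ?_
        (by linarith) (hKle _ (by linarith))
      calc _ ≤ W * ((c₂ + 2) * Real.log (kappa A lam / (ε * γ))) :=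
            mul_le_mul_of_nonneg_left hE hW
        _ = (c₂ + 2) * (W * Real.log (kappa A lam / (ε * γ))) := by ring
        _ ≤ _ := by
            gcongr
            linarith
    · refine timeLE_pcProj_of_le hc₁ hε0 hε hγ0 hγ hd hnnz hT (B := 2 * c₁ + c₂ + 6) (by linarith)
        (hΛ.trans hΛδ) ?_ (by linarith) (hKle _ (by linarith))
      have hΛδ0 : 0 ≤ Real.log (kappa A lam / (ε * γ * δ)) := by linarith
      calc _ ≤ W * ((2 * c₁ + c₂ + 6) * Real.log (kappa A lam / (ε * γ * δ))) :=
            mul_le_mul_of_nonneg_left hD hW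
        _ = (2 * c₁ + c₂ + 6) * (W * Real.log (kappa A lam / (ε * γ * δ))) := by ring
        _ ≤ _ := by
            gcongr
            linarith
    · exact hsure _ fun z => fail_agdRidge A hlam hε' _ z
    · refine timeLE_pcProj_of_le hc₁ hε0 hε hγ0 hγ hd hnnz (fun x => timeLE_agdRidge A x _ _)
        (B := 48 * c₂ + 171) ?_ hΛ (agd_time_le hc₂ hlam hκ hε0 hε hγ0 hγ hd hnnz) (by linarith)
        (hKle _ (by linarith))
      refine le_mul_of_one_le_right hnn ?_
      rw [← Real.sqrt_one]
      exact Real.sqrt_le_sqrt hκ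
    · exact hprob _ (isRidgeSolver_svrgRidge A hA hlam)
    · refine timeLE_pcProj_of_le hc₁ hε0 hε hγ0 hγ hd hnnz (fun x => timeLE_svrgRidge A hA x _ _)
        (B := 24 + 230 * (4 * c₁ + 4 * c₂ + 17)) ?_ (hΛ.trans hΛδ)
        (svrg_time_le hc₁ hc₂ hlam hκ hε0 hε hγ0 hγ hδ0 hδ1 hd hnnz hd1) (by linarith)
        (hKle _ (by linarith))
      have h3 : 0 ≤ stableRank A :=
        div_nonneg (Finset.sum_nonneg fun i _ => rowSq_nonneg A i) (sq_nonneg _)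
      have h4 : 0 ≤ (d : ℝ) * stableRank A * kappa A lam := by positivity
      linarith
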